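/- There is an absolute constant $C>0$ with the following property. Let $u_0,u_1:\mathbb R^3\to\mathbb R$ be smooth and radially symmetric, with $u_0\in L^\infty(\mathbb R^3)$ and $(u_0,u_1)\in\dot H^1(\mathbb R^3)\times L^2(\mathbb R^3)$, and suppose that for some $\epsilon>0$ $$(u_0)_r+|u_1|\le\frac{1-\epsilon}{r}\qquad\text{for all } r=|x|>0 .$$ Here $\dot H^1(\mathbb R^3)=\{f\in L^6(\mathbb R^3):\nabla f\in L^2(\mathbb R^3)\}$, $\|f\|_{\dot H^1}=\|\nabla f\|_{L^2}$ and $\|(f,g)\|_{\dot H^1\times L^2}=(\|f\|_{\dot H^1}^2+\|g\|_{L^2}^2)^{1/2}$. Then the equation $$u_{tt}-\Delta u=u_t^2-|\nabla u|^2,\qquad u(0)=u_0,\quad u_t(0)=u_1,$$ has a global smooth solution on $\mathbb R^3\times\mathbb R$, and every global smooth solution $u$ satisfies $u\in L^\infty_t\dot H^1_x\cap L^2_tL^\infty_x$, $u_t\in L^\infty_tL^2_x$ and $$\sup_{t\in\mathbb R}\|(u(t),u_t(t))\|_{\dot H^1\times L^2}\le e^{\sup u_0-\inf u_0}\,\epsilon^{-1}\,\|(u_0,u_1)\|_{\dot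 H^1\times L^2},$$ $$\Big(\int_{\mathbb R}\|u(t)\|_{L^\infty_x}^2\,dt\Big)^{1/2}\le C\,\max\big(1,e^{\sup u_0}\epsilon^{-1}\big)\,e^{-\inf u_0}\,\|(u_0,u_1)\|_{\dot H^1\times L^2}.$$ -/

import Mathlib

open MeasureTheory Set
open scoped ENNReal ContDiff Laplacian Gradient

noncomputable section

/-- Three-dimensional Euclidean space. -/
abbrev E3 : Type := EuclideanSpace ℝ (Fin 3)

/-- A function on space is radial if it depends only on the distance to the origin. -/
def IsRadial (f : E3 → ℝ) : Prop := ∀ x y : E3, ‖x‖ = ‖y‖ → f x = f y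

/-- The radial derivative `f_r (x) = ∇ f(x) · x / |x|`, meaningful for `x ≠ 0`. -/
def radialDeriv (f : E3 → ℝ) (x : E3) : ℝ := fderiv ℝ f x (‖x‖⁻¹ • x)

/-- The time derivative `u_t (t, x)`. -/
def timeDeriv (u : ℝ → E3 → ℝ) (t : ℝ) (x : E3) : ℝ := deriv (fun s => u s x) t

/-- `u` is a global smooth solution on `ℝ × ℝ³` of
`u_tt - Δ u = u_t ^ 2 - |∇ u| ^ 2`, `u(0) = u₀`, `u_t(0) = u₁`. -/
structure IsNullFormSolution (u : ℝ → E3 → ℝ) (u₀ u₁ : E3 → ℝ) : Prop where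
  smooth : ContDiff ℝ ∞ (fun p : ℝ × E3 => u p.1 p.2)
  equation : ∀ (t : ℝ) (x : E3),
    timeDeriv (timeDeriv u) t x - Δ (u t) x = timeDeriv u t x ^ 2 - ‖∇ (u t) x‖ ^ 2
  init : ∀ x : E3, u 0 x = u₀ x
  init_deriv : ∀ x : E3, timeDeriv u 0 x = u₁ x

/-- The homogeneous Sobolev norm `‖∇ f‖_{L²}` of a smooth function, as an extended real. -/
def hDotNorm (f : E3 → ℝ) : ℝ≥0∞ := eLpNorm (∇ f) 2 volume

/-- Membership of a smooth function in the homogeneous Sobolev space `Ḣ¹(ℝ³)`, the completion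
of the test functions under `‖∇ f‖_{L²}`: by the Sobolev embedding this is the space of
`f ∈ L⁶` with `∇ f ∈ L²`. In particular nonzero constants are excluded. -/
def MemHDot (f : E3 → ℝ) : Prop := MemLp f 6 volume ∧ MemLp (∇ f) 2 volume

/-- The norm `(‖f‖²_{Ḣ¹} + ‖g‖²_{L²})^{1/2}` of `Ḣ¹ × L²`. -/
def energyNorm (f g : E3 → ℝ) : ℝ≥0∞ :=
  (hDotNorm f ^ 2 + eLpNorm g 2 volume ^ 2) ^ (1 / 2 : ℝ)

/-- The norm of `L²_t L^∞_x`, over all times `t ∈ ℝ`. -/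
def normL2Linfty (u : ℝ → E3 → ℝ) : ℝ≥0∞ :=
  (∫⁻ t : ℝ, eLpNorm (u t) ⊤ volume ^ 2) ^ (1 / 2 : ℝ)

end

/-!
If `u` solves the null-form equation then `v = exp (-u)` solves the linear wave equation, so `u` can
blow up only at a zero of `v`. For radial `v` the function `r v` solves the one-dimensional wave
equation in `(t, r)` and is odd in `r`; hence `v (t, x)` is the average over `[t - |x|, t + |x|]` of
a single profile `h`, determined by the data. The hypothesis `(u₀)_r + |u₁| ≤ (1 - ε) / r` says
that `h ≥ ε exp (-sup u₀)`, and then `v` has the same lower bound.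

The bound on the energy norm is conservation of energy for `v`, together with
`|∇ v| = exp (-u) |∇ u|`; uniqueness of `v` is the same energy estimate, localised to light cones.
For the `L²L^∞` bound, `v - 1` is an average of `h - 1`, hence dominated, uniformly in `x`, by the
Hardy–Littlewood maximal function of `h - 1` at `t`. Here `h - 1 ∈ L²(ℝ)` by Hardy's inequality for
the data.
-/

open Filter Topology

section MaximalFunction

variable {X : Type*} [PseudoMetricSpace X] [MeasurableSpace X] {μ : Measure X}

/-- The uncentred Hardy–Littlewood maximal function: the supremum of the averages of `g` over the
balls containing `x`. -/
noncomputable def maximalFunction (μ : Measure X) (g : X → ℝ≥0∞) (x : X) : ℝ≥0∞ :=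
  ⨆ (c : X) (r : ℝ) (_ : x ∈ Metric.ball c r), ⨍⁻ y in Metric.ball c r, g y ∂μ

theorem setLAverage_le_maximalFunction (g : X → ℝ≥0∞) {c x : X} {r : ℝ}
    (hx : x ∈ Metric.ball c r) : ⨍⁻ y in Metric.ball c r, g y ∂μ ≤ maximalFunction μ g x :=
  le_iSup₂_of_le c r <| le_iSup_of_le hx le_rfl

theorem setOf_lt_maximalFunction (g : X → ℝ≥0∞) (a : ℝ≥0∞) :
    {x | a < maximalFunction μ g x} =
      ⋃ (c : X) (r : ℝ) (_ : a < ⨍⁻ y in Metric.ball c r, g y ∂μ), Metric.ball c r := by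
  ext x
  simp only [maximalFunction, mem_ofPred_eq, lt_iSup_iff, mem_iUnion, exists_prop, and_comm]

theorem lowerSemicontinuous_maximalFunction (g : X → ℝ≥0∞) :
    LowerSemicontinuous (maximalFunction μ g) := by
  refine lowerSemicontinuous_iff_isOpen_preimage.2 fun a => ?_
  change IsOpen {x | a < maximalFunction μ g x}
  rw [setOf_lt_maximalFunction]
  exact isOpen_iUnion fun c => isOpen_iUnion fun r => isOpen_iUnion fun _ => Metric.isOpen_ball

theorem pos_of_lt_setLAverage_ball {g : X → ℝ≥0∞} {a : ℝ≥0∞} {c : X} {r : ℝ}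
    (h : a < ⨍⁻ y in Metric.ball c r, g y ∂μ) : 0 < r := by
  by_contra! hr
  simp [Metric.ball_eq_empty.2 hr] at h

theorem mul_measure_le_of_le_setLAverage {α : Type*} [MeasurableSpace α] {ν : Measure α}
    {g : α → ℝ≥0∞} {a : ℝ≥0∞} {s : Set α} (h : a ≤ ⨍⁻ y in s, g y ∂ν) :
    a * ν s ≤ ∫⁻ y in s, g y ∂ν := by
  rw [setLAverage_eq] at h
  exact ENNReal.mul_le_of_le_div h

theorem maximalFunction_le_add [ProperSpace X] [μ.IsOpenPosMeasure]
    [IsFiniteMeasureOnCompacts μ] (g : X → ℝ≥0∞) (a : ℝ≥0∞) (x : X) :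
    maximalFunction μ g x ≤ a + maximalFunction μ ({y | a < g y}.indicator g) x := by
  refine iSup₂_le fun c r => iSup_le fun hx => ?_
  have hball : μ (Metric.ball c r) ≠ 0 :=
    (Metric.measure_ball_pos μ c (Metric.pos_of_mem_ball hx)).ne'
  have hsplit : ∀ y, g y ≤ a + {y | a < g y}.indicator g y := fun y => by
    by_cases hy : a < g y
    · rw [indicator_of_mem (by exact hy)]; exact le_add_self
    · exact (not_lt.1 hy).trans le_self_add
  calc ⨍⁻ y in Metric.ball c r, g y ∂μ
      ≤ ⨍⁻ y in Metric.ball c r, (a + {y | a < g y}.indicator g y) ∂μ := lintegral_mono hsplit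
    _ = a + ⨍⁻ y in Metric.ball c r, {y | a < g y}.indicator g y ∂μ := by
        rw [setLAverage_eq, setLAverage_eq, lintegral_add_left measurable_const, ENNReal.add_div,
          setLIntegral_const, ENNReal.mul_div_cancel_right hball measure_ball_lt_top.ne]
    _ ≤ a + maximalFunction μ ({y | a < g y}.indicator g) x := by
        gcongr; exact setLAverage_le_maximalFunction _ hx

end MaximalFunction

theorem setLIntegral_Ioo_rpow {q : ℝ} (hq : 0 < q) {B : ℝ} (hB : 0 ≤ B) :
    ∫⁻ l in Ioo 0 B, ENNReal.ofReal (q * l ^ (q - 1)) = ENNReal.ofReal (B ^ q) := by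
  have hint : IntegrableOn (fun l : ℝ => q * l ^ (q - 1)) (Ioc 0 B) :=
    ((intervalIntegral.intervalIntegrable_rpow' (by linarith)).const_mul q).1
  have hnonneg : ∀ᵐ l ∂volume.restrict (Ioc 0 B), 0 ≤ q * l ^ (q - 1) := by
    filter_upwards [ae_restrict_mem measurableSet_Ioc] with l hl
    exact mul_nonneg hq.le (Real.rpow_nonneg hl.1.le _)
  rw [restrict_Ioo_eq_restrict_Ioc, ← ofReal_integral_eq_lintegral_ofReal hint hnonneg,
    ← intervalIntegral.integral_of_le hB, intervalIntegral.integral_const_mul,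
    integral_rpow (Or.inl (by linarith)), sub_add_cancel, Real.zero_rpow hq.ne', sub_zero,
    mul_div_cancel₀ _ hq.ne']

theorem lintegral_Ioi_indicator_rpow {q : ℝ} (hq : 0 < q) (b : ℝ≥0∞) :
    ∫⁻ l in Ioi (0 : ℝ), {l : ℝ | ENNReal.ofReal l < b}.indicator
      (fun l => ENNReal.ofReal (q * l ^ (q - 1))) l = b ^ q := by
  rw [setLIntegral_indicator (measurableSet_lt ENNReal.measurable_ofReal measurable_const)]
  rcases eq_or_ne b ⊤ with rfl | hb
  · rw [ENNReal.top_rpow_of_pos hq]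
    refine ENNReal.eq_top_of_forall_nnreal_le fun r => ?_
    calc (r : ℝ≥0∞) = ENNReal.ofReal (((r : ℝ) ^ q⁻¹) ^ q) := by
          rw [Real.rpow_inv_rpow r.coe_nonneg hq.ne', ENNReal.ofReal_coe_nnreal]
      _ = ∫⁻ l in Ioo 0 ((r : ℝ) ^ q⁻¹), ENNReal.ofReal (q * l ^ (q - 1)) :=
          (setLIntegral_Ioo_rpow hq (by positivity)).symm
      _ ≤ ∫⁻ l in {l : ℝ | ENNReal.ofReal l < ⊤} ∩ Ioi 0, ENNReal.ofReal (q * l ^ (q - 1)) :=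
          lintegral_mono_set fun l hl => ⟨ENNReal.ofReal_lt_top, hl.1⟩
  · lift b to NNReal using hb
    have hset : {l : ℝ | ENNReal.ofReal l < b} ∩ Ioi 0 = Ioo 0 (b : ℝ) := by
      ext l
      simp only [mem_inter_iff, mem_ofPred_eq, mem_Ioi, mem_Ioo]
      exact ⟨fun h => ⟨h.2, (ENNReal.ofReal_lt_coe_iff h.2.le).1 h.1⟩,
        fun h => ⟨(ENNReal.ofReal_lt_coe_iff h.1.le).2 h.2, h.1⟩⟩
    rw [hset, setLIntegral_Ioo_rpow hq b.coe_nonneg,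
      ← ENNReal.ofReal_rpow_of_nonneg b.coe_nonneg hq.le, ENNReal.ofReal_coe_nnreal]

theorem lintegral_rpow_eq_lintegral_measure_lt {α : Type*} [MeasurableSpace α] (ν : Measure α)
    [SFinite ν] {q : ℝ} (hq : 0 < q) {f : α → ℝ≥0∞} (hf : Measurable f) :
    ∫⁻ x, f x ^ q ∂ν =
      ∫⁻ l in Ioi (0 : ℝ), ENNReal.ofReal (q * l ^ (q - 1)) * ν {x | ENNReal.ofReal l < f x} := by
  have hmeas : Measurable (Function.uncurry fun (x : α) (l : ℝ) =>
      {l : ℝ | ENNReal.ofReal l < f x}.indicator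
        (fun l => ENNReal.ofReal (q * l ^ (q - 1))) l) :=
    (by fun_prop : Measurable fun z : α × ℝ => ENNReal.ofReal (q * z.2 ^ (q - 1))).indicator
      (measurableSet_lt (by fun_prop : Measurable fun z : α × ℝ => ENNReal.ofReal z.2)
        (hf.comp measurable_fst))
  simp_rw [← lintegral_Ioi_indicator_rpow hq]
  rw [lintegral_lintegral_swap hmeas.aemeasurable]
  refine lintegral_congr fun l => ?_
  exact lintegral_indicator_const (measurableSet_lt measurable_const hf) _

theorem lintegral_withDensity_two_mul_rpow {α : Type*} [MeasurableSpace α] (ν : Measure α)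
    {q : ℝ} (hq : 0 ≤ q) {g : α → ℝ≥0∞} (hg : Measurable g) :
    ∫⁻ x, (2 * g x) ^ q ∂ν.withDensity g = 2 ^ q * ∫⁻ x, g x ^ (q + 1) ∂ν := by
  rw [lintegral_withDensity_eq_lintegral_mul _ hg (by fun_prop),
    ← lintegral_const_mul _ (by fun_prop)]
  refine lintegral_congr fun x => ?_
  rw [Pi.mul_apply, ENNReal.mul_rpow_of_nonneg _ _ hq, mul_left_comm,
    ENNReal.rpow_add_of_nonneg _ _ hq zero_le_one, ENNReal.rpow_one, mul_comm (g x)]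

section HardyLittlewood

variable {E : Type*} [NormedAddCommGroup E] [NormedSpace ℝ E] [FiniteDimensional ℝ E]
  [Nontrivial E] [MeasurableSpace E] [BorelSpace E] {μ : Measure E} [μ.IsAddHaarMeasure]

theorem exists_radius_le_of_lt_setLAverage_ball {g : E → ℝ≥0∞} {a : ℝ≥0∞}
    (ha : a ≠ 0) (hg : ∫⁻ x, g x ∂μ ≠ ⊤) :
    ∃ R : ℝ, ∀ c r, a < ⨍⁻ y in Metric.ball c r, g y ∂μ → r ≤ R := by
  let V := μ (Metric.ball (0 : E) 1)
  have hV : V ≠ 0 := (Metric.measure_ball_pos μ 0 one_pos).ne'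
  refine ⟨max 1 ((∫⁻ x, g x ∂μ) / (a * V)).toReal, fun c r h => ?_⟩
  rcases le_total r 1 with hr1 | hr1
  · exact hr1.trans (le_max_left _ _)
  have hr : 0 < r := pos_of_lt_setLAverage_ball h
  have hbound : ENNReal.ofReal (r ^ Module.finrank ℝ E) ≤ (∫⁻ x, g x ∂μ) / (a * V) := by
    rw [ENNReal.le_div_iff_mul_le (Or.inl (mul_ne_zero ha hV))
      (Or.inl (ENNReal.mul_ne_top h.ne_top measure_ball_lt_top.ne)), mul_left_comm,
      ← Measure.addHaar_ball μ c hr.le]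
    exact (mul_measure_le_of_le_setLAverage h.le).trans (setLIntegral_le_lintegral _ _)
  have hpow : r ≤ r ^ Module.finrank ℝ E := le_self_pow₀ hr1 Module.finrank_pos.ne'
  exact hpow.trans <| ((ENNReal.ofReal_le_iff_le_toReal
    (ENNReal.div_ne_top hg (mul_ne_zero ha hV))).1 hbound).trans (le_max_right _ _)

theorem mul_measure_lt_maximalFunction_le (g : E → ℝ≥0∞) (a : ℝ≥0∞) :
    a * μ {x | a < maximalFunction μ g x} ≤ 5 ^ Module.finrank ℝ E * ∫⁻ x, g x ∂μ := by
  rcases eq_or_ne a 0 with rfl | ha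
  · simp
  rcases eq_or_ne (∫⁻ x, g x ∂μ) ⊤ with hg | hg
  · simp [hg]
  let T : Set (E × ℝ) := {p | a < ⨍⁻ y in Metric.ball p.1 p.2, g y ∂μ}
  obtain ⟨R, hR⟩ := exists_radius_le_of_lt_setLAverage_ball ha hg
  obtain ⟨U, hUT, hdisj, hcov⟩ := Vitali.exists_disjoint_subfamily_covering_enlargement_ball
    T (fun p => p.1) (fun p => p.2) R (fun p hp => hR p.1 p.2 hp) 5 (by norm_num)
  have hUc : U.Countable := hdisj.countable_of_isOpen (fun p _ => Metric.isOpen_ball)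
    fun p hp => Metric.nonempty_ball.2 (pos_of_lt_setLAverage_ball (hUT hp))
  have hsub : {x | a < maximalFunction μ g x} ⊆ ⋃ p ∈ U, Metric.ball p.1 (5 * p.2) := by
    rw [setOf_lt_maximalFunction]
    refine iUnion_subset fun c => iUnion_subset fun r => iUnion_subset fun h => ?_
    obtain ⟨q, hqU, hq⟩ := hcov (c, r) h
    exact hq.trans (subset_biUnion_of_mem (u := fun p => Metric.ball p.1 (5 * p.2)) hqU)
  calc a * μ {x | a < maximalFunction μ g x}
      ≤ a * ∑' p : U, μ (Metric.ball p.1.1 (5 * p.1.2)) := by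
        gcongr
        exact (measure_mono hsub).trans (measure_biUnion_le _ hUc _)
    _ = ∑' p : U, 5 ^ Module.finrank ℝ E * (a * μ (Metric.ball p.1.1 p.1.2)) := by
        rw [← ENNReal.tsum_mul_left]
        refine tsum_congr fun p => ?_
        rw [Measure.addHaar_ball_mul_of_pos μ _ (by norm_num : (0 : ℝ) < 5),
          Measure.addHaar_ball_center μ p.1.1, ENNReal.ofReal_pow (by norm_num),
          ENNReal.ofReal_ofNat, mul_left_comm]
    _ ≤ ∑' p : U, 5 ^ Module.finrank ℝ E * ∫⁻ x in Metric.ball p.1.1 p.1.2, g x ∂μ := by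
        gcongr with p
        exact mul_measure_le_of_le_setLAverage (hUT p.2).le
    _ = 5 ^ Module.finrank ℝ E * ∫⁻ x in ⋃ p ∈ U, Metric.ball p.1 p.2, g x ∂μ := by
        rw [ENNReal.tsum_mul_left,
          lintegral_biUnion hUc (fun p _ => Metric.isOpen_ball.measurableSet) hdisj]
    _ ≤ 5 ^ Module.finrank ℝ E * ∫⁻ x, g x ∂μ := by gcongr; exact Measure.restrict_le_self

theorem ofReal_mul_measure_lt_maximalFunction_le {g : E → ℝ≥0∞} (hg : Measurable g) (l : ℝ) :
    ENNReal.ofReal l * μ {x | ENNReal.ofReal l < maximalFunction μ g x} ≤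
      2 * 5 ^ Module.finrank ℝ E * μ.withDensity g {x | ENNReal.ofReal l < 2 * g x} := by
  let a := ENNReal.ofReal (l / 2)
  have ha : ENNReal.ofReal l = 2 * a := by
    rw [← ENNReal.ofReal_ofNat, ← ENNReal.ofReal_mul zero_le_two, mul_div_cancel₀ l two_ne_zero]
  have hsub : {x | ENNReal.ofReal l < maximalFunction μ g x} ⊆
      {x | a < maximalFunction μ ({y | a < g y}.indicator g) x} := fun x hx => by
    have hlt := lt_of_lt_of_le hx (maximalFunction_le_add (μ := μ) g a x)
    rw [ha, two_mul] at hlt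
    exact (ENNReal.add_lt_add_iff_left ENNReal.ofReal_ne_top).1 hlt
  have hset : {x | ENNReal.ofReal l < 2 * g x} = {x | a < g x} := by
    ext x
    simp only [mem_ofPred_eq, ha, ENNReal.mul_lt_mul_iff_right two_ne_zero ENNReal.ofNat_ne_top]
  calc ENNReal.ofReal l * μ {x | ENNReal.ofReal l < maximalFunction μ g x}
      ≤ 2 * (a * μ {x | a < maximalFunction μ ({y | a < g y}.indicator g) x}) := by
        rw [ha, mul_assoc, ← ha]; gcongr
    _ ≤ 2 * (5 ^ Module.finrank ℝ E * ∫⁻ x, {y | a < g y}.indicator g x ∂μ) := by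
        gcongr 2 * ?_; exact mul_measure_lt_maximalFunction_le _ a
    _ = 2 * 5 ^ Module.finrank ℝ E * μ.withDensity g {x | ENNReal.ofReal l < 2 * g x} := by
        have hmeas : MeasurableSet {x | a < g x} := measurableSet_lt measurable_const hg
        rw [hset, withDensity_apply _ hmeas, lintegral_indicator hmeas, mul_assoc]

theorem ofReal_rpow_mul_measure_lt_maximalFunction_le {p l : ℝ} (hp : 1 < p) (hl : 0 < l)
    {g : E → ℝ≥0∞} (hg : Measurable g) :
    ENNReal.ofReal (p * l ^ (p - 1)) * μ {x | ENNReal.ofReal l < maximalFunction μ g x} ≤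
      ENNReal.ofReal (p / (p - 1)) * (2 * 5 ^ Module.finrank ℝ E) *
        (ENNReal.ofReal ((p - 1) * l ^ (p - 1 - 1)) *
          μ.withDensity g {x | ENNReal.ofReal l < 2 * g x}) := by
  have hp1 : 0 < p - 1 := sub_pos.2 hp
  have hfactor : p * l ^ (p - 1) = p / (p - 1) * ((p - 1) * l ^ (p - 1 - 1)) * l := by
    rw [Real.rpow_sub_one hl.ne' (p - 1)]; field_simp
  rw [hfactor, ENNReal.ofReal_mul' hl.le, ENNReal.ofReal_mul (by positivity), mul_assoc]
  refine (mul_le_mul' le_rfl (ofReal_mul_measure_lt_maximalFunction_le hg l)).trans_eq ?_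
  ring

theorem lintegral_maximalFunction_rpow_le {p : ℝ} (hp : 1 < p) {g : E → ℝ≥0∞}
    (hg : Measurable g) :
    ∫⁻ x, maximalFunction μ g x ^ p ∂μ ≤
      ENNReal.ofReal (2 ^ p * p / (p - 1)) * 5 ^ Module.finrank ℝ E * ∫⁻ x, g x ^ p ∂μ := by
  have hp1 : 0 < p - 1 := sub_pos.2 hp
  let K : ℝ≥0∞ := ENNReal.ofReal (p / (p - 1)) * (2 * 5 ^ Module.finrank ℝ E)
  calc ∫⁻ x, maximalFunction μ g x ^ p ∂μ
      = ∫⁻ l in Ioi (0 : ℝ),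
          ENNReal.ofReal (p * l ^ (p - 1)) * μ {x | ENNReal.ofReal l < maximalFunction μ g x} :=
        lintegral_rpow_eq_lintegral_measure_lt μ (by linarith)
          (lowerSemicontinuous_maximalFunction g).measurable
    _ ≤ ∫⁻ l in Ioi (0 : ℝ), K * (ENNReal.ofReal ((p - 1) * l ^ (p - 1 - 1)) *
          μ.withDensity g {x | ENNReal.ofReal l < 2 * g x}) :=
        setLIntegral_mono' measurableSet_Ioi fun l hl =>
          ofReal_rpow_mul_measure_lt_maximalFunction_le hp hl hg
    _ = K * ∫⁻ x, (2 * g x) ^ (p - 1) ∂μ.withDensity g := by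
        rw [lintegral_const_mul' _ _ (by finiteness),
          lintegral_rpow_eq_lintegral_measure_lt _ hp1 (by fun_prop)]
    _ = K * (2 ^ (p - 1) * ∫⁻ x, g x ^ p ∂μ) := by
        rw [lintegral_withDensity_two_mul_rpow μ hp1.le hg, sub_add_cancel]
    _ = ENNReal.ofReal (2 ^ p * p / (p - 1)) * 5 ^ Module.finrank ℝ E * ∫⁻ x, g x ^ p ∂μ := by
        have hconst : ENNReal.ofReal (2 ^ p * p / (p - 1)) =
            ENNReal.ofReal (p / (p - 1)) * 2 * 2 ^ (p - 1) := by
          rw [mul_assoc, ← ENNReal.ofReal_ofNat 2, ENNReal.ofReal_rpow_of_pos two_pos,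
            ← ENNReal.ofReal_mul zero_le_two, ← ENNReal.ofReal_mul (by positivity),
            Real.rpow_sub_one two_ne_zero]
          congr 1; ring
        rw [hconst]
        ring

end HardyLittlewood

section DirDeriv

variable {F G : Type*} [NormedAddCommGroup F] [NormedSpace ℝ F] [NormedAddCommGroup G]
  [NormedSpace ℝ G] {f g : F → ℝ}

/-- The derivative of `f` in the constant direction `v`, as an operator on functions, so that it can
be iterated. -/
noncomputable def dirDeriv (v : F) (f : F → ℝ) (p : F) : ℝ := fderiv ℝ f p v

theorem continuous_dirDeriv (hf : ContDiff ℝ 1 f) (v : F) : Continuous (dirDeriv v f) :=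
  (hf.continuous_fderiv one_ne_zero).clm_apply continuous_const

theorem contDiff_dirDeriv (hf : ContDiff ℝ ∞ f) (v : F) : ContDiff ℝ ∞ (dirDeriv v f) :=
  (hf.fderiv_right (m := ∞) (by simp)).clm_apply contDiff_const

theorem dirDeriv_dirDeriv (hf : ContDiff ℝ 2 f) (v w p : F) :
    dirDeriv v (dirDeriv w f) p = fderiv ℝ (fderiv ℝ f) p v w := by
  have hd : DifferentiableAt ℝ (fderiv ℝ f) p :=
    (hf.fderiv_right (m := 1) (by norm_num)).differentiable one_ne_zero p
  have h := (hd.hasFDerivAt.clm_apply (hasFDerivAt_const w p)).fderiv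
  change fderiv ℝ (fun q => fderiv ℝ f q w) p v = _
  rw [h, ContinuousLinearMap.comp_zero, zero_add, ContinuousLinearMap.flip_apply]

theorem dirDeriv_comm (hf : ContDiff ℝ 2 f) (v w p : F) :
    dirDeriv v (dirDeriv w f) p = dirDeriv w (dirDeriv v f) p := by
  rw [dirDeriv_dirDeriv hf, dirDeriv_dirDeriv hf]
  exact hf.contDiffAt.isSymmSndFDerivAt (by simp) v w

theorem dirDeriv_mul {p : F} (hf : DifferentiableAt ℝ f p) (hg : DifferentiableAt ℝ g p) (v : F) :
    dirDeriv v (fun q => f q * g q) p = dirDeriv v f p * g p + f p * dirDeriv v g p := by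
  simp only [dirDeriv, fderiv_fun_mul hf hg, add_apply,
    smul_apply, smul_eq_mul]
  ring

theorem dirDeriv_sq {p : F} (hf : DifferentiableAt ℝ f p) (v : F) :
    dirDeriv v (fun q => f q ^ 2) p = 2 * f p * dirDeriv v f p := by
  simp only [sq, dirDeriv_mul hf hf]
  ring

theorem dirDeriv_const_mul {p : F} (hf : DifferentiableAt ℝ f p) (c : ℝ) (v : F) :
    dirDeriv v (fun q => c * f q) p = c * dirDeriv v f p := by
  simp only [dirDeriv, fderiv_const_mul hf, smul_apply, smul_eq_mul]

theorem dirDeriv_add {p : F} (hf : DifferentiableAt ℝ f p) (hg : DifferentiableAt ℝ g p) (v : F) :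
    dirDeriv v (fun q => f q + g q) p = dirDeriv v f p + dirDeriv v g p := by
  simp only [dirDeriv, fderiv_fun_add hf hg, add_apply]

theorem dirDeriv_sub {p : F} (hf : DifferentiableAt ℝ f p) (hg : DifferentiableAt ℝ g p) (v : F) :
    dirDeriv v (fun q => f q - g q) p = dirDeriv v f p - dirDeriv v g p := by
  simp only [dirDeriv, fderiv_fun_sub hf hg, sub_apply]

theorem dirDeriv_sum {ι : Type*} {s : Finset ι} {h : ι → F → ℝ} {p : F}
    (hh : ∀ i ∈ s, DifferentiableAt ℝ (h i) p) (v : F) :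
    dirDeriv v (fun q => ∑ i ∈ s, h i q) p = ∑ i ∈ s, dirDeriv v (h i) p := by
  simp only [dirDeriv, fderiv_fun_sum hh, sum_apply]

theorem dirDeriv_neg_dir (v : F) (f : F → ℝ) : dirDeriv (-v) f = fun p => -dirDeriv v f p :=
  funext fun _ => map_neg _ _

theorem dirDeriv_neg (v : F) (f : F → ℝ) :
    dirDeriv v (fun p => -f p) = fun p => -dirDeriv v f p := by
  ext p; simp only [dirDeriv, fderiv_fun_neg, neg_apply]

theorem dirDeriv_comp_hasDerivAt {φ : ℝ → ℝ} {φ' : ℝ} {p : F} (hφ : HasDerivAt φ φ' (f p))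
    (hf : DifferentiableAt ℝ f p) (v : F) :
    dirDeriv v (fun q => φ (f q)) p = φ' * dirDeriv v f p :=
  congrArg (· v) (hφ.comp_hasFDerivAt p hf.hasFDerivAt).fderiv

theorem dirDeriv_dirDeriv_comp {φ φ' : ℝ → ℝ} {φ'' : ℝ} {p : F} (hf : ContDiff ℝ ∞ f)
    (hφ : ∀ q, HasDerivAt φ (φ' (f q)) (f q)) (hφ' : HasDerivAt φ' φ'' (f p)) (v : F) :
    dirDeriv v (dirDeriv v fun q => φ (f q)) p =
      φ'' * dirDeriv v f p ^ 2 + φ' (f p) * dirDeriv v (dirDeriv v f) p := by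
  have hdiff : Differentiable ℝ f := hf.differentiable (by simp)
  rw [funext fun q => dirDeriv_comp_hasDerivAt (hφ q) (hdiff q) v,
    dirDeriv_mul (f := fun q => φ' (f q)) (hφ'.differentiableAt.comp p (hdiff p))
      ((contDiff_dirDeriv hf v).differentiable (by simp) p),
    dirDeriv_comp_hasDerivAt hφ' (hdiff p)]
  ring

theorem hasDerivAt_exp_neg (x : ℝ) : HasDerivAt (fun x => Real.exp (-x)) (-Real.exp (-x)) x := by
  simpa using (hasDerivAt_neg x).exp

theorem dirDeriv_exp_neg (hf : Differentiable ℝ f) (v p : F) :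
    dirDeriv v (fun q => Real.exp (-f q)) p = -Real.exp (-f p) * dirDeriv v f p :=
  dirDeriv_comp_hasDerivAt (hasDerivAt_exp_neg _) (hf p) v

theorem dirDeriv_neg_log {p : F} (hf : DifferentiableAt ℝ f p) (hp : f p ≠ 0) (v : F) :
    dirDeriv v (fun q => -Real.log (f q)) p = -(f p)⁻¹ * dirDeriv v f p :=
  dirDeriv_comp_hasDerivAt (Real.hasDerivAt_log hp).neg hf v

theorem dirDeriv_comp_clm {h : G → ℝ} (hh : Differentiable ℝ h) (L : F →L[ℝ] G) (v : F) :
    dirDeriv v (fun p => h (L p)) = fun p => dirDeriv (L v) h (L p) := by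
  ext p
  exact congrArg (· v) ((hh (L p)).hasFDerivAt.comp p L.hasFDerivAt).fderiv

end DirDeriv

section SpaceTime

variable {E : Type*} [NormedAddCommGroup E]

/-- The time direction `(1, 0)` of space-time `ℝ × E`; spatial directions are written `(0, v)`. -/
def timeDir : ℝ × E := (1, 0)

variable {P : ℝ × E → ℝ} {R : ℝ}

/-- `P` vanishes near every point `(t, x)` with `0 ≤ t` and `R ≤ ‖x‖`. Asking for a neighbourhood
makes the property stable under differentiation. -/
def VanishesBeyond (R : ℝ) (P : ℝ × E → ℝ) : Prop :=
  ∀ t x, 0 ≤ t → R ≤ ‖x‖ → P =ᶠ[𝓝 (t, x)] 0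

namespace VanishesBeyond

theorem mul_right (hR : VanishesBeyond R P) (Q : ℝ × E → ℝ) :
    VanishesBeyond R fun p => P p * Q p := fun t x ht hx => by
  filter_upwards [hR t x ht hx] with p hp
  simp [hp]

theorem hasCompactSupport_slice [ProperSpace E] (hR : VanishesBeyond R P) {t : ℝ} (ht : 0 ≤ t) :
    HasCompactSupport fun x => P (t, x) := by
  refine HasCompactSupport.of_support_subset_isCompact (isCompact_closedBall (0 : E) R) ?_
  intro x hx
  rw [mem_closedBall_zero_iff]
  by_contra! h
  exact hx (hR t x ht h.le).eq_of_nhds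

end VanishesBeyond

variable [NormedSpace ℝ E]

/-- The reflection `(t, x) ↦ (-t, x)` of space-time. -/
noncomputable def timeReflection : ℝ × E →L[ℝ] ℝ × E :=
  (-ContinuousLinearMap.fst ℝ ℝ E).prod (ContinuousLinearMap.snd ℝ ℝ E)

theorem timeReflection_mk (t : ℝ) (x : E) : timeReflection (t, x) = (-t, x) := rfl

theorem timeReflection_timeDir : timeReflection timeDir = -(timeDir : ℝ × E) := by
  simp [timeReflection, timeDir]

theorem hasDerivAt_time (hP : Differentiable ℝ P) (t : ℝ) (x : E) :
    HasDerivAt (fun t => P (t, x)) (dirDeriv timeDir P (t, x)) t :=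
  (hP (t, x)).hasFDerivAt.comp_hasDerivAt t ((hasDerivAt_id t).prodMk (hasDerivAt_const t x))

theorem dirDeriv_slice (hP : Differentiable ℝ P) (t : ℝ) (v : E) :
    dirDeriv v (fun x => P (t, x)) = fun x => dirDeriv (0, v) P (t, x) := by
  ext x
  exact congrArg (· v) ((hP (t, x)).hasFDerivAt.comp x (hasFDerivAt_prodMk_right t x)).fderiv

namespace VanishesBeyond

theorem dirDeriv (hR : VanishesBeyond R P) (v : ℝ × E) : VanishesBeyond R (dirDeriv v P) :=
  fun t x ht hx => by
    filter_upwards [(hR t x ht hx).eventuallyEq_nhds] with q hq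
    simp [_root_.dirDeriv, hq.fderiv_eq]

variable [FiniteDimensional ℝ E] [MeasurableSpace E] [BorelSpace E] {μ : Measure E}
  [IsFiniteMeasureOnCompacts μ]

theorem integrable_slice (hR : VanishesBeyond R P) (hP : Continuous P) {t : ℝ} (ht : 0 ≤ t) :
    Integrable (fun x => P (t, x)) μ :=
  have := FiniteDimensional.proper_real E
  (hP.comp (by fun_prop)).integrable_of_hasCompactSupport (hR.hasCompactSupport_slice ht)

theorem integrable_slab [SFinite μ] (hR : VanishesBeyond R P) (hP : Continuous P) (T : ℝ) :
    Integrable P ((volume.restrict (Ioc 0 T)).prod μ) := by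
  have := FiniteDimensional.proper_real E
  have hcylinder : IntegrableOn P (Icc 0 T ×ˢ Metric.closedBall (0 : E) R) (volume.prod μ) :=
    hP.continuousOn.integrableOn_compact (isCompact_Icc.prod (isCompact_closedBall _ _))
  have hslab : IntegrableOn P (Icc 0 T ×ˢ univ) (volume.prod μ) := by
    refine hcylinder.of_forall_sdiff_eq_zero (measurableSet_Icc.prod MeasurableSet.univ) ?_
    rintro ⟨t, x⟩ ⟨h, h'⟩
    refine (hR t x h.1.1 ?_).eq_of_nhds
    by_contra! hx
    exact h' ⟨h.1, mem_closedBall_zero_iff.2 hx.le⟩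
  have := hslab.mono_set (prod_mono_left (Ioc_subset_Icc_self (a := (0 : ℝ)) (b := T)))
  rwa [IntegrableOn, ← Measure.prod_restrict, Measure.restrict_univ] at this

theorem integral_slice_sub [SFinite μ] (hR : VanishesBeyond R P) (hP : ContDiff ℝ 1 P) {T : ℝ}
    (hT : 0 ≤ T) : (∫ x, P (T, x) ∂μ) - ∫ x, P (0, x) ∂μ =
      ∫ t in Ioc 0 T, ∫ x, _root_.dirDeriv timeDir P (t, x) ∂μ := by
  have hc := continuous_dirDeriv hP timeDir
  rw [integral_integral_swap (f := fun t x => _root_.dirDeriv timeDir P (t, x))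
      ((hR.dirDeriv timeDir).integrable_slab hc T),
    ← integral_sub (hR.integrable_slice hP.continuous hT)
      (hR.integrable_slice hP.continuous le_rfl)]
  refine integral_congr_ae (ae_of_all _ fun x => ?_)
  simp only
  rw [← intervalIntegral.integral_of_le hT, intervalIntegral.integral_eq_sub_of_hasDerivAt
    (fun t _ => hasDerivAt_time (hP.differentiable one_ne_zero) t x)]
  exact (hc.comp (by fun_prop : Continuous fun t : ℝ => (t, x))).intervalIntegrable _ _

end VanishesBeyond

variable [FiniteDimensional ℝ E] [MeasurableSpace E] [BorelSpace E] {μ : Measure E}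
  [μ.IsAddHaarMeasure]

theorem integral_dirDeriv_eq_zero_of_hasCompactSupport {f : E → ℝ} (hf : ContDiff ℝ 1 f)
    (hc : HasCompactSupport f) (v : E) : ∫ x, dirDeriv v f x ∂μ = 0 := by
  have hint : Integrable (fun x => fderiv ℝ f x v) μ :=
    (continuous_dirDeriv hf v).integrable_of_hasCompactSupport (hc.fderiv_apply ℝ v)
  simpa [dirDeriv] using integral_mul_fderiv_eq_neg_fderiv_mul_of_integrable (μ := μ)
    (f := fun _ => (1 : ℝ)) (g := f) (v := v) (by simp) (by simpa using hint)
    (by simpa using hf.continuous.integrable_of_hasCompactSupport hc)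
    (fun x _ => differentiableAt_const _) (fun x _ => hf.differentiable one_ne_zero x)

theorem integral_slice_le_of_divergence_nonpos {ι : Type*} [Fintype ι] (v : ι → E)
    {Q : ι → ℝ × E → ℝ} (hP : ContDiff ℝ 1 P) (hPR : VanishesBeyond R P)
    (hQ : ∀ i, ContDiff ℝ 1 (Q i)) (hQR : ∀ i, VanishesBeyond R (Q i))
    (hdiv : ∀ p, dirDeriv timeDir P p + ∑ i, dirDeriv (0, v i) (Q i) p ≤ 0) {T : ℝ}
    (hT : 0 ≤ T) : ∫ x, P (T, x) ∂μ ≤ ∫ x, P (0, x) ∂μ := by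
  rw [← sub_nonpos, hPR.integral_slice_sub hP hT]
  refine setIntegral_nonpos measurableSet_Ioc fun t ht => ?_
  have ht : 0 ≤ t := ht.1.le
  have hflux_int : ∀ i, Integrable (fun x => dirDeriv (0, v i) (Q i) (t, x)) μ := fun i =>
    ((hQR i).dirDeriv _).integrable_slice (continuous_dirDeriv (hQ i) _) ht
  have hflux : ∫ x, ∑ i, dirDeriv (0, v i) (Q i) (t, x) ∂μ = 0 := by
    rw [integral_finsetSum _ fun i _ => hflux_int i]
    refine Finset.sum_eq_zero fun i _ => ?_
    rw [← dirDeriv_slice ((hQ i).differentiable one_ne_zero)]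
    exact integral_dirDeriv_eq_zero_of_hasCompactSupport
      ((hQ i).comp (contDiff_const.prodMk contDiff_id))
      (have := FiniteDimensional.proper_real E; (hQR i).hasCompactSupport_slice ht) (v i)
  calc ∫ x, dirDeriv timeDir P (t, x) ∂μ
      = ∫ x, (dirDeriv timeDir P (t, x) + ∑ i, dirDeriv (0, v i) (Q i) (t, x)) ∂μ := by
        rw [integral_add ((hPR.dirDeriv _).integrable_slice (continuous_dirDeriv hP _) ht)
          (integrable_finsetSum _ fun i _ => hflux_int i), hflux, add_zero]
    _ ≤ 0 := integral_nonpos fun x => hdiv (t, x)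

end SpaceTime

section ConeCutoff

variable {E : Type*} [NormedAddCommGroup E]

/-- A smooth cutoff to the backward light cone of height `R`. The distance to the axis is smoothed
to `√(1 + ‖x‖²)`, whose gradient still has norm less than one. -/
noncomputable def coneCutoff (R : ℝ) (p : ℝ × E) : ℝ :=
  Real.smoothTransition (R - p.1 - √(1 + ‖p.2‖ ^ 2))

theorem coneCutoff_nonneg (R : ℝ) (p : ℝ × E) : 0 ≤ coneCutoff R p :=
  Real.smoothTransition.nonneg _

theorem coneCutoff_le_one (R : ℝ) (p : ℝ × E) : coneCutoff R p ≤ 1 :=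
  Real.smoothTransition.le_one _

theorem eventually_coneCutoff_eq_one (p : ℝ × E) : ∀ᶠ n : ℕ in atTop, coneCutoff n p = 1 := by
  obtain ⟨N, hN⟩ := exists_nat_ge (1 + p.1 + √(1 + ‖p.2‖ ^ 2))
  filter_upwards [eventually_ge_atTop N] with n hn
  have : (N : ℝ) ≤ n := by exact_mod_cast hn
  exact Real.smoothTransition.one_of_one_le (by linarith)

theorem vanishesBeyond_coneCutoff (R : ℝ) : VanishesBeyond R (coneCutoff (E := E) R) := by
  intro t x ht hx
  have hcont : Continuous fun p : ℝ × E => R - p.1 - √(1 + ‖p.2‖ ^ 2) := by fun_prop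
  have hneg : R - t - √(1 + ‖x‖ ^ 2) < 0 := by
    linarith [Real.lt_sqrt_of_sq_lt (x := ‖x‖) (y := 1 + ‖x‖ ^ 2) (by linarith)]
  filter_upwards [hcont.continuousAt.eventually_lt (continuousAt_const (y := (0 : ℝ))) hneg]
    with p hp
  exact Real.smoothTransition.zero_of_nonpos hp.le

variable [InnerProductSpace ℝ E]

theorem contDiff_coneCutoff (R : ℝ) : ContDiff ℝ ∞ (coneCutoff (E := E) R) := by
  refine Real.smoothTransition.contDiff.comp ?_
  refine (contDiff_const.sub contDiff_fst).sub (ContDiff.sqrt ?_ fun p => by positivity)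
  exact contDiff_const.add (contDiff_snd.norm_sq ℝ)

theorem dirDeriv_coneCutoff (R : ℝ) (v p : ℝ × E) :
    dirDeriv v (coneCutoff R) p =
      -(deriv Real.smoothTransition (R - p.1 - √(1 + ‖p.2‖ ^ 2)) *
        (v.1 + inner ℝ p.2 v.2 / √(1 + ‖p.2‖ ^ 2))) := by
  have hq : (0 : ℝ) < 1 + ‖p.2‖ ^ 2 := by positivity
  have harg : HasFDerivAt (fun p : ℝ × E => R - p.1 - √(1 + ‖p.2‖ ^ 2)) _ p :=
    ((hasFDerivAt_fst (𝕜 := ℝ) (p := p)).const_sub R).sub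
      ((((hasFDerivAt_snd (𝕜 := ℝ) (p := p)).norm_sq).const_add 1).sqrt hq.ne')
  have hη : DifferentiableAt ℝ Real.smoothTransition (R - p.1 - √(1 + ‖p.2‖ ^ 2)) :=
    (Real.smoothTransition.contDiff (n := 1)).differentiable one_ne_zero _
  have hcutoff : fderiv ℝ (coneCutoff R) p = _ := (hη.hasDerivAt.comp_hasFDerivAt p harg).fderiv
  rw [dirDeriv, hcutoff]
  simp only [one_div, mul_inv_rev, smul_apply, sub_apply, neg_apply, ContinuousLinearMap.coe_fst',
    ContinuousLinearMap.comp_apply, ContinuousLinearMap.coe_snd', coe_innerSL_apply, nsmul_eq_mul,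
    Nat.cast_ofNat, smul_eq_mul]
  ring

end ConeCutoff

section LinearWave

theorem two_mul_sum_mul_le {ι : Type*} [Fintype ι] (a : ℝ) {c d : ι → ℝ}
    (hd : ∑ i, d i ^ 2 ≤ 1) : 2 * a * ∑ i, d i * c i ≤ a ^ 2 + ∑ i, c i ^ 2 := by
  have hsq : ∑ i, (c i - a * d i) ^ 2 =
      ∑ i, c i ^ 2 - 2 * a * ∑ i, d i * c i + a ^ 2 * ∑ i, d i ^ 2 := by
    simp only [Finset.mul_sum, ← Finset.sum_sub_distrib, ← Finset.sum_add_distrib]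
    exact Finset.sum_congr rfl fun i _ => by ring
  have hnonneg : 0 ≤ ∑ i, (c i - a * d i) ^ 2 := by positivity
  linarith [mul_le_of_le_one_right (sq_nonneg a) hd]

variable {E : Type*} [NormedAddCommGroup E] [InnerProductSpace ℝ E] [FiniteDimensional ℝ E]

/-- The coordinate directions of space-time `ℝ × E` along an orthonormal basis of space. -/
noncomputable def spaceDir (i : Fin (Module.finrank ℝ E)) : ℝ × E := (0, stdOrthonormalBasis ℝ E i)

/-- The d'Alembertian `W_tt - Δ W` of a function on space-time. -/
noncomputable def dAlembertian (W : ℝ × E → ℝ) (p : ℝ × E) : ℝ :=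
  dirDeriv timeDir (dirDeriv timeDir W) p - ∑ i, dirDeriv (spaceDir i) (dirDeriv (spaceDir i) W) p

/-- Smooth solutions `W` of the linear wave equation on `ℝ × E`. -/
structure IsLinearWave (W : ℝ × E → ℝ) : Prop where
  smooth : ContDiff ℝ ∞ W
  equation : ∀ p, dAlembertian W p = 0

/-- The energy density `W_t ^ 2 + |∇ W| ^ 2` of a function on space-time. -/
noncomputable def energyDensity (W : ℝ × E → ℝ) (p : ℝ × E) : ℝ :=
  dirDeriv timeDir W p ^ 2 + ∑ i, dirDeriv (spaceDir i) W p ^ 2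

variable {W : ℝ × E → ℝ}

theorem energyDensity_nonneg (W : ℝ × E → ℝ) (p : ℝ × E) : 0 ≤ energyDensity W p := by
  unfold energyDensity; positivity

theorem contDiff_energyDensity (hW : ContDiff ℝ ∞ W) : ContDiff ℝ ∞ (energyDensity W) :=
  ((contDiff_dirDeriv hW _).pow 2).add (ContDiff.sum fun _ _ => (contDiff_dirDeriv hW _).pow 2)

theorem dirDeriv_energyDensity (hW : ContDiff ℝ ∞ W) (v p : ℝ × E) :
    dirDeriv v (energyDensity W) p = 2 * dirDeriv timeDir W p * dirDeriv v (dirDeriv timeDir W) p +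
      ∑ i, 2 * dirDeriv (spaceDir i) W p * dirDeriv v (dirDeriv (spaceDir i) W) p := by
  have hd : ∀ w, DifferentiableAt ℝ (dirDeriv w W) p := fun w =>
    (contDiff_dirDeriv hW w).differentiable (by simp) p
  change dirDeriv v (fun q => dirDeriv timeDir W q ^ 2 + ∑ i, dirDeriv (spaceDir i) W q ^ 2) p = _
  rw [dirDeriv_add ((hd _).fun_pow 2) (DifferentiableAt.fun_sum fun i _ => (hd _).fun_pow 2),
    dirDeriv_sum fun i _ => (hd _).fun_pow 2, dirDeriv_sq (hd _)]
  simp only [dirDeriv_sq (hd _)]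

/-- The flux in direction `i` of the energy of `W` weighted by `c`. -/
noncomputable def energyFlux (c W : ℝ × E → ℝ) (i : Fin (Module.finrank ℝ E)) (p : ℝ × E) : ℝ :=
  c p * (-2 * (dirDeriv timeDir W p * dirDeriv (spaceDir i) W p))

theorem contDiff_energyFlux {c : ℝ × E → ℝ} (hc : ContDiff ℝ ∞ c) (hW : ContDiff ℝ ∞ W)
    (i : Fin (Module.finrank ℝ E)) : ContDiff ℝ ∞ (energyFlux c W i) :=
  hc.mul (contDiff_const.mul ((contDiff_dirDeriv hW _).mul (contDiff_dirDeriv hW _)))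

theorem dirDeriv_energyFlux {c : ℝ × E → ℝ} (hc : ContDiff ℝ ∞ c) (hW : ContDiff ℝ ∞ W)
    (i : Fin (Module.finrank ℝ E)) (v p : ℝ × E) :
    dirDeriv v (energyFlux c W i) p =
      dirDeriv v c p * (-2 * (dirDeriv timeDir W p * dirDeriv (spaceDir i) W p)) +
      c p * (-2 * (dirDeriv v (dirDeriv timeDir W) p * dirDeriv (spaceDir i) W p +
        dirDeriv timeDir W p * dirDeriv v (dirDeriv (spaceDir i) W) p)) := by
  have hd : ∀ w, DifferentiableAt ℝ (dirDeriv w W) p := fun w =>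
    (contDiff_dirDeriv hW w).differentiable (by simp) p
  change dirDeriv v (fun q => c q * (-2 * (dirDeriv timeDir W q * dirDeriv (spaceDir i) W q))) p = _
  rw [dirDeriv_mul (hc.differentiable (by simp) p) (((hd _).fun_mul (hd _)).const_mul (-2)),
    dirDeriv_const_mul ((hd _).fun_mul (hd _)), dirDeriv_mul (hd _) (hd _)]

namespace IsLinearWave

theorem divergence_eq (hW : IsLinearWave W) {c : ℝ × E → ℝ} (hc : ContDiff ℝ ∞ c) (p : ℝ × E) :
    dirDeriv timeDir (fun p => c p * energyDensity W p) p +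
      ∑ i, dirDeriv (spaceDir i) (energyFlux c W i) p =
    dirDeriv timeDir c p * energyDensity W p -
      2 * dirDeriv timeDir W p * ∑ i, dirDeriv (spaceDir i) c p * dirDeriv (spaceDir i) W p := by
  have hW2 : ContDiff ℝ 2 W := hW.smooth.of_le (WithTop.coe_le_coe.2 le_top)
  rw [dirDeriv_mul (hc.differentiable (by simp) p)
      ((contDiff_energyDensity hW.smooth).differentiable (by simp) p),
    dirDeriv_energyDensity hW.smooth, sub_eq_zero.1 (hW.equation p)]
  simp only [dirDeriv_energyFlux hc hW.smooth,
    dirDeriv_comm hW2 timeDir (spaceDir _)]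
  rw [add_assoc, sub_eq_add_neg]
  simp only [mul_add, Finset.mul_sum, ← Finset.sum_add_distrib, ← Finset.sum_neg_distrib]
  congr 1
  exact Finset.sum_congr rfl fun i _ => by ring

theorem divergence_coneCutoff_nonpos (hW : IsLinearWave W) (R : ℝ) (p : ℝ × E) :
    dirDeriv timeDir (fun p => coneCutoff R p * energyDensity W p) p +
      ∑ i, dirDeriv (spaceDir i) (energyFlux (coneCutoff R) W i) p ≤ 0 := by
  rw [hW.divergence_eq (contDiff_coneCutoff R)]
  set s := √(1 + ‖p.2‖ ^ 2)
  set slope := deriv Real.smoothTransition (R - p.1 - s)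
  have hslope : 0 ≤ slope := Real.smoothTransition.monotone.deriv_nonneg
  have hgrad : ∑ i, (inner ℝ p.2 (stdOrthonormalBasis ℝ E i) / s) ^ 2 ≤ 1 := by
    simp only [div_pow, ← Finset.sum_div, OrthonormalBasis.sum_sq_inner_left, s]
    rw [Real.sq_sqrt (by positivity), div_le_one (by positivity)]
    linarith
  have htime : dirDeriv timeDir (coneCutoff R) p = -slope := by
    simp [dirDeriv_coneCutoff, timeDir, slope, s]
  have hspace : ∀ i, dirDeriv (spaceDir i) (coneCutoff R) p =
      -(slope * (inner ℝ p.2 (stdOrthonormalBasis ℝ E i) / s)) := fun i => by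
    simp [dirDeriv_coneCutoff, spaceDir, slope, s]
  have hflux := two_mul_sum_mul_le (dirDeriv timeDir W p)
    (c := fun i => dirDeriv (spaceDir i) W p) hgrad
  simp only [htime, hspace, neg_mul, mul_assoc slope, Finset.sum_neg_distrib, ← Finset.mul_sum]
  have := mul_le_mul_of_nonneg_left hflux hslope
  unfold energyDensity
  linarith

variable [MeasurableSpace E] [BorelSpace E] {μ : Measure E} [μ.IsAddHaarMeasure]

theorem integral_coneCutoff_mul_energyDensity_le (hW : IsLinearWave W) (R : ℝ) {T : ℝ}
    (hT : 0 ≤ T) : ∫ x, coneCutoff R (T, x) * energyDensity W (T, x) ∂μ ≤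
      ∫ x, coneCutoff R (0, x) * energyDensity W (0, x) ∂μ := by
  have hc := contDiff_coneCutoff (E := E) R
  exact integral_slice_le_of_divergence_nonpos (fun i => stdOrthonormalBasis ℝ E i)
    (P := fun p => coneCutoff R p * energyDensity W p)
    ((hc.mul (contDiff_energyDensity hW.smooth)).of_le (by simp))
    ((vanishesBeyond_coneCutoff R).mul_right _)
    (fun i => (contDiff_energyFlux hc hW.smooth i).of_le (by simp))
    (fun i => (vanishesBeyond_coneCutoff R).mul_right _)
    (hW.divergence_coneCutoff_nonpos R) hT

theorem lintegral_coneCutoff_mul_energyDensity_le (hW : IsLinearWave W) (R : ℝ) {T : ℝ}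
    (hT : 0 ≤ T) : ∫⁻ x, ENNReal.ofReal (coneCutoff R (T, x) * energyDensity W (T, x)) ∂μ ≤
      ∫⁻ x, ENNReal.ofReal (energyDensity W (0, x)) ∂μ := by
  have hint : ∀ t : ℝ, 0 ≤ t →
      Integrable (fun x => coneCutoff R (t, x) * energyDensity W (t, x)) μ := fun t ht =>
    ((vanishesBeyond_coneCutoff R).mul_right _).integrable_slice
      ((contDiff_coneCutoff R).continuous.mul (contDiff_energyDensity hW.smooth).continuous) ht
  have hnonneg : ∀ p, 0 ≤ coneCutoff R p * energyDensity W p := fun p =>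
    mul_nonneg (coneCutoff_nonneg R p) (energyDensity_nonneg W p)
  rw [← ofReal_integral_eq_lintegral_ofReal (hint T hT) (ae_of_all _ fun x => hnonneg _)]
  refine (ENNReal.ofReal_le_ofReal (hW.integral_coneCutoff_mul_energyDensity_le R hT)).trans ?_
  rw [ofReal_integral_eq_lintegral_ofReal (hint 0 le_rfl) (ae_of_all _ fun x => hnonneg _)]
  exact lintegral_mono fun x => ENNReal.ofReal_le_ofReal <|
    mul_le_of_le_one_left (energyDensity_nonneg W _) (coneCutoff_le_one R _)

theorem lintegral_energyDensity_le_of_nonneg (hW : IsLinearWave W) {T : ℝ} (hT : 0 ≤ T) :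
    ∫⁻ x, ENNReal.ofReal (energyDensity W (T, x)) ∂μ ≤
      ∫⁻ x, ENNReal.ofReal (energyDensity W (0, x)) ∂μ := by
  have he := (contDiff_energyDensity hW.smooth).continuous
  have hlim : ∀ x, Tendsto (fun n : ℕ =>
      ENNReal.ofReal (coneCutoff n (T, x) * energyDensity W (T, x))) atTop
      (𝓝 (ENNReal.ofReal (energyDensity W (T, x)))) := fun x => by
    refine tendsto_const_nhds.congr' ?_
    filter_upwards [eventually_coneCutoff_eq_one (T, x)] with n hn
    rw [hn, one_mul]
  calc ∫⁻ x, ENNReal.ofReal (energyDensity W (T, x)) ∂μ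
      = ∫⁻ x, liminf (fun n : ℕ =>
          ENNReal.ofReal (coneCutoff n (T, x) * energyDensity W (T, x))) atTop ∂μ := by
        simp_rw [fun x => (hlim x).liminf_eq]
    _ ≤ liminf (fun n : ℕ => ∫⁻ x,
          ENNReal.ofReal (coneCutoff n (T, x) * energyDensity W (T, x)) ∂μ) atTop := by
        refine lintegral_liminf_le fun n => ENNReal.measurable_ofReal.comp ?_
        exact (((contDiff_coneCutoff n).continuous.mul he).comp
          (by fun_prop : Continuous fun x : E => (T, x))).measurable
    _ ≤ ∫⁻ x, ENNReal.ofReal (energyDensity W (0, x)) ∂μ := by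
        refine liminf_le_of_le (by isBoundedDefault) fun b hb => ?_
        obtain ⟨n, hn⟩ := hb.exists
        exact hn.trans (hW.lintegral_coneCutoff_mul_energyDensity_le n hT)

end IsLinearWave

theorem timeReflection_spaceDir (i : Fin (Module.finrank ℝ E)) :
    timeReflection (spaceDir i : ℝ × E) = spaceDir i := by
  simp [timeReflection, spaceDir]

theorem energyDensity_comp_timeReflection (hW : Differentiable ℝ W) (p : ℝ × E) :
    energyDensity (fun p => W (timeReflection p)) p = energyDensity W (timeReflection p) := by
  simp only [energyDensity, dirDeriv_comp_clm hW, timeReflection_timeDir,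
    timeReflection_spaceDir, dirDeriv_neg_dir, neg_sq]

namespace IsLinearWave

theorem comp_timeReflection (hW : IsLinearWave W) :
    IsLinearWave fun p => W (timeReflection p) where
  smooth := hW.smooth.comp (timeReflection (E := E)).contDiff
  equation p := by
    have h0 : Differentiable ℝ W := hW.smooth.differentiable (by simp)
    have h1 : ∀ v, Differentiable ℝ (dirDeriv v W) := fun v =>
      (contDiff_dirDeriv hW.smooth v).differentiable (by simp)
    rw [← hW.equation (timeReflection p)]
    simp only [dAlembertian, dirDeriv_comp_clm h0, dirDeriv_comp_clm (h1 _),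
      timeReflection_timeDir, timeReflection_spaceDir, dirDeriv_neg_dir, dirDeriv_neg, neg_neg]

theorem sub {V : ℝ × E → ℝ} (hW : IsLinearWave W) (hV : IsLinearWave V) :
    IsLinearWave fun p => W p - V p where
  smooth := hW.smooth.sub hV.smooth
  equation p := by
    have h0 : ∀ v, dirDeriv v (fun p => W p - V p) = fun p => dirDeriv v W p - dirDeriv v V p :=
      fun v => funext fun p => dirDeriv_sub (hW.smooth.differentiable (by simp) p)
        (hV.smooth.differentiable (by simp) p) v
    have hW1 := fun v => (contDiff_dirDeriv hW.smooth v).differentiable (by simp) p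
    have hV1 := fun v => (contDiff_dirDeriv hV.smooth v).differentiable (by simp) p
    simp only [dAlembertian, h0, dirDeriv_sub (hW1 _) (hV1 _), Finset.sum_sub_distrib,
      sub_eq_zero.1 (hW.equation p), sub_eq_zero.1 (hV.equation p), sub_self]

theorem const_mul (hW : IsLinearWave W) (c : ℝ) : IsLinearWave fun p => c * W p where
  smooth := contDiff_const.mul hW.smooth
  equation p := by
    have h0 : ∀ v, dirDeriv v (fun p => c * W p) = fun p => c * dirDeriv v W p := fun v =>
      funext fun p => dirDeriv_const_mul (hW.smooth.differentiable (by simp) p) c v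
    have h1 := fun v => (contDiff_dirDeriv hW.smooth v).differentiable (by simp) p
    simp only [dAlembertian, h0, dirDeriv_const_mul (h1 _), ← Finset.mul_sum,
      sub_eq_zero.1 (hW.equation p), sub_self]

variable [MeasurableSpace E] [BorelSpace E]

theorem lintegral_energyDensity_le {μ : Measure E} [μ.IsAddHaarMeasure] (hW : IsLinearWave W)
    (T : ℝ) : ∫⁻ x, ENNReal.ofReal (energyDensity W (T, x)) ∂μ ≤
      ∫⁻ x, ENNReal.ofReal (energyDensity W (0, x)) ∂μ := by
  rcases le_total 0 T with hT | hT
  · exact hW.lintegral_energyDensity_le_of_nonneg hT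
  · have := hW.comp_timeReflection.lintegral_energyDensity_le_of_nonneg (μ := μ) (neg_nonneg.2 hT)
    simpa only [energyDensity_comp_timeReflection (hW.smooth.differentiable (by simp)),
      timeReflection_mk, neg_neg, neg_zero] using this

end IsLinearWave

theorem energyDensity_eq_zero_of_initial (hW : Differentiable ℝ W) (h0 : ∀ x, W (0, x) = 0)
    (h1 : ∀ x, dirDeriv timeDir W (0, x) = 0) (x : E) : energyDensity W (0, x) = 0 := by
  have hspace : ∀ i, dirDeriv (spaceDir i) W (0, x) = 0 := fun i => by
    have := congrFun (dirDeriv_slice hW 0 (stdOrthonormalBasis ℝ E i)) x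
    rw [spaceDir, ← this]
    simp [dirDeriv, h0]
  simp [energyDensity, h1, hspace]

namespace IsLinearWave

theorem energyDensity_eq_zero (hW : IsLinearWave W) (h0 : ∀ x, energyDensity W (0, x) = 0)
    (p : ℝ × E) : energyDensity W p = 0 := by
  borelize E
  have hc : Continuous fun x => energyDensity W (p.1, x) :=
    (contDiff_energyDensity hW.smooth).continuous.comp (by fun_prop)
  have hzero : ∫⁻ x, ENNReal.ofReal (energyDensity W (p.1, x)) = 0 :=
    le_antisymm ((hW.lintegral_energyDensity_le p.1).trans (by simp [h0])) zero_le
  rw [lintegral_eq_zero_iff hc.measurable.ennreal_ofReal] at hzero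
  have hae : (fun x => energyDensity W (p.1, x)) =ᵐ[volume] fun _ => 0 := by
    filter_upwards [hzero] with x hx
    exact le_antisymm (ENNReal.ofReal_eq_zero.1 hx) (energyDensity_nonneg W _)
  exact congrFun ((hc.ae_eq_iff_eq volume continuous_const).1 hae) p.2

theorem eq_zero (hW : IsLinearWave W) (h0 : ∀ x, W (0, x) = 0)
    (h1 : ∀ x, dirDeriv timeDir W (0, x) = 0) (p : ℝ × E) : W p = 0 := by
  have hdiff : Differentiable ℝ W := hW.smooth.differentiable (by simp)
  have htime : ∀ q, dirDeriv timeDir W q = 0 := fun q => by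
    have henergy := hW.energyDensity_eq_zero (energyDensity_eq_zero_of_initial hdiff h0 h1) q
    rw [energyDensity, add_eq_zero_iff_of_nonneg (sq_nonneg _) (by positivity)] at henergy
    exact pow_eq_zero_iff two_ne_zero |>.1 henergy.1
  have hconst := is_const_of_deriv_eq_zero (f := fun t => W (t, p.2))
    (fun t => (hasDerivAt_time hdiff t p.2).differentiableAt)
    (fun t => by rw [(hasDerivAt_time hdiff t p.2).deriv, htime]) p.1 0
  simpa [h0] using hconst

theorem ext_of_initial {V : ℝ × E → ℝ} (hW : IsLinearWave W) (hV : IsLinearWave V)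
    (h0 : ∀ x, W (0, x) = V (0, x))
    (h1 : ∀ x, dirDeriv timeDir W (0, x) = dirDeriv timeDir V (0, x)) : W = V := by
  ext p
  refine sub_eq_zero.1 ((hW.sub hV).eq_zero (fun x => by simp [h0]) (fun x => ?_) p)
  rw [dirDeriv_sub (hW.smooth.differentiable (by simp) _) (hV.smooth.differentiable (by simp) _),
    h1, sub_self]

end IsLinearWave

end LinearWave

section NullForm

variable {E : Type*} [NormedAddCommGroup E] [InnerProductSpace ℝ E] [FiniteDimensional ℝ E]

/-- The null form `W_t ^ 2 - |∇ W| ^ 2`. -/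
noncomputable def nullForm (W : ℝ × E → ℝ) (p : ℝ × E) : ℝ :=
  dirDeriv timeDir W p ^ 2 - ∑ i, dirDeriv (spaceDir i) W p ^ 2

/-- Smooth solutions of `U_tt - Δ U = U_t ^ 2 - |∇ U| ^ 2` on `ℝ × E`: the equation of
`IsNullFormSolution`, without initial data and for a function of space-time. -/
structure IsNullFormWave (U : ℝ × E → ℝ) : Prop where
  smooth : ContDiff ℝ ∞ U
  equation : ∀ p, dAlembertian U p = nullForm U p

variable {U W : ℝ × E → ℝ}

theorem dAlembertian_comp {φ φ' : ℝ → ℝ} {φ'' : ℝ} {p : ℝ × E} (hW : ContDiff ℝ ∞ W)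
    (hφ : ∀ q, HasDerivAt φ (φ' (W q)) (W q)) (hφ' : HasDerivAt φ' φ'' (W p)) :
    dAlembertian (fun q => φ (W q)) p = φ'' * nullForm W p + φ' (W p) * dAlembertian W p := by
  simp only [dAlembertian, nullForm, dirDeriv_dirDeriv_comp hW hφ hφ', Finset.sum_add_distrib,
    ← Finset.mul_sum]
  ring

theorem energyDensity_exp_neg (hU : Differentiable ℝ U) (p : ℝ × E) :
    energyDensity (fun p => Real.exp (-U p)) p = Real.exp (-U p) ^ 2 * energyDensity U p := by
  simp only [energyDensity, dirDeriv_exp_neg hU, mul_pow, neg_sq, ← Finset.mul_sum, mul_add]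

theorem IsNullFormWave.exp_neg (hU : IsNullFormWave U) :
    IsLinearWave fun p => Real.exp (-U p) where
  smooth := hU.smooth.neg.exp
  equation p := by
    rw [dAlembertian_comp hU.smooth (fun q => hasDerivAt_exp_neg (U q))
      (hasDerivAt_exp_neg _).fun_neg, hU.equation]
    ring

theorem IsLinearWave.neg_log (hW : IsLinearWave W) (hpos : ∀ p, 0 < W p) :
    IsNullFormWave fun p => -Real.log (W p) where
  smooth := (hW.smooth.log fun p => (hpos p).ne').neg
  equation p := by
    have hlog : ∀ q, HasDerivAt (fun x => -Real.log x) (-(W q)⁻¹) (W q) := fun q =>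
      (Real.hasDerivAt_log (hpos q).ne').neg
    have hinv : HasDerivAt (fun x => -x⁻¹) ((W p)⁻¹ ^ 2) (W p) := by
      simpa using (hasDerivAt_inv (hpos p).ne').fun_neg
    have hdir := dirDeriv_neg_log (hW.smooth.differentiable (by simp) p) (hpos p).ne'
    rw [dAlembertian_comp hW.smooth hlog hinv, hW.equation]
    simp only [nullForm, hdir, mul_pow, neg_sq, ← Finset.mul_sum]
    ring

theorem laplacian_slice (hW : ContDiff ℝ ∞ W) (t : ℝ) (x : E) :
    Δ (fun x => W (t, x)) x = ∑ i, dirDeriv (spaceDir i) (dirDeriv (spaceDir i) W) (t, x) := by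
  have hslice : ContDiff ℝ ∞ fun x => W (t, x) := hW.comp (contDiff_const.prodMk contDiff_id)
  rw [congrFun (InnerProductSpace.laplacian_eq_iteratedFDeriv_stdOrthonormalBasis _) x]
  refine Finset.sum_congr rfl fun i _ => ?_
  rw [iteratedFDeriv_two_apply, spaceDir,
    ← congrFun (dirDeriv_slice ((contDiff_dirDeriv hW _).differentiable (by simp)) t _) x,
    ← dirDeriv_slice (hW.differentiable (by simp)),
    dirDeriv_dirDeriv (hslice.of_le (WithTop.coe_le_coe.2 le_top))]
  rfl

theorem norm_gradient_sq (f : E → ℝ) (x : E) :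
    ‖∇ f x‖ ^ 2 = ∑ i, dirDeriv (stdOrthonormalBasis ℝ E i) f x ^ 2 := by
  rw [← (stdOrthonormalBasis ℝ E).sum_sq_inner_left]
  simp only [dirDeriv, gradient, InnerProductSpace.toDual_symm_apply]

theorem norm_gradient_slice_sq (hW : Differentiable ℝ W) (t : ℝ) (x : E) :
    ‖∇ (fun x => W (t, x)) x‖ ^ 2 = ∑ i, dirDeriv (spaceDir i) W (t, x) ^ 2 := by
  simp only [norm_gradient_sq, dirDeriv_slice hW, spaceDir]

end NullForm

section Slices

variable {u : ℝ → E3 → ℝ} {u₀ u₁ : E3 → ℝ} {U : ℝ × E3 → ℝ}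

theorem timeDeriv_eq_dirDeriv (hU : Differentiable ℝ U) :
    timeDeriv (fun t x => U (t, x)) = fun t x => dirDeriv timeDir U (t, x) := by
  ext t x
  exact (hasDerivAt_time hU t x).deriv

theorem energyDensity_eq_timeDeriv_gradient (hU : Differentiable ℝ U) (t : ℝ) (x : E3) :
    energyDensity U (t, x) =
      timeDeriv (fun t x => U (t, x)) t x ^ 2 + ‖∇ (fun x => U (t, x)) x‖ ^ 2 := by
  rw [norm_gradient_slice_sq hU, timeDeriv_eq_dirDeriv hU, energyDensity]

theorem dAlembertian_eq_timeDeriv_laplacian (hU : ContDiff ℝ ∞ U) (t : ℝ) (x : E3) :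
    dAlembertian U (t, x) =
      timeDeriv (timeDeriv fun t x => U (t, x)) t x - Δ (fun x => U (t, x)) x := by
  rw [laplacian_slice hU, timeDeriv_eq_dirDeriv (hU.differentiable (by simp)),
    timeDeriv_eq_dirDeriv ((contDiff_dirDeriv hU _).differentiable (by simp)), dAlembertian]

theorem nullForm_eq_timeDeriv_gradient (hU : Differentiable ℝ U) (t : ℝ) (x : E3) :
    nullForm U (t, x) =
      timeDeriv (fun t x => U (t, x)) t x ^ 2 - ‖∇ (fun x => U (t, x)) x‖ ^ 2 := by
  rw [norm_gradient_slice_sq hU, timeDeriv_eq_dirDeriv hU, nullForm]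

theorem IsNullFormWave.isNullFormSolution (hU : IsNullFormWave U) :
    IsNullFormSolution (fun t x => U (t, x)) (fun x => U (0, x))
      (fun x => dirDeriv timeDir U (0, x)) where
  smooth := hU.smooth
  equation t x := by
    rw [← dAlembertian_eq_timeDeriv_laplacian hU.smooth,
      ← nullForm_eq_timeDeriv_gradient (hU.smooth.differentiable (by simp)), hU.equation]
  init _ := rfl
  init_deriv x := congrFun₂ (timeDeriv_eq_dirDeriv (hU.smooth.differentiable (by simp))) 0 x

namespace IsNullFormSolution

theorem isNullFormWave (hu : IsNullFormSolution u u₀ u₁) :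
    IsNullFormWave fun p : ℝ × E3 => u p.1 p.2 where
  smooth := hu.smooth
  equation := fun (t, x) => by
    rw [dAlembertian_eq_timeDeriv_laplacian hu.smooth,
      nullForm_eq_timeDeriv_gradient (hu.smooth.differentiable (by simp))]
    exact hu.equation t x

theorem dirDeriv_timeDir_zero (hu : IsNullFormSolution u u₀ u₁) (x : E3) :
    dirDeriv timeDir (fun p : ℝ × E3 => u p.1 p.2) (0, x) = u₁ x := by
  rw [← hu.init_deriv x]
  exact (congrFun₂ (timeDeriv_eq_dirDeriv (hu.smooth.differentiable (by simp))) 0 x).symm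

end IsNullFormSolution

end Slices

section WeightedMean

theorem hasFDerivAt_intervalIntegral_of_continuous {H G : Type*} [NormedAddCommGroup H]
    [NormedSpace ℝ H] [ProperSpace H] [NormedAddCommGroup G] [NormedSpace ℝ G]
    {F : H → ℝ → G} {F' : H → ℝ → H →L[ℝ] G} (hF : ∀ q, Continuous (F q))
    (hF' : Continuous (Function.uncurry F'))
    (hderiv : ∀ q s, HasFDerivAt (fun q => F q s) (F' q s) q) (a b : ℝ) (p : H) :
    HasFDerivAt (fun q => ∫ s in a..b, F q s) (∫ s in a..b, F' p s) p := by
  obtain ⟨C, hC⟩ := ((isCompact_closedBall p 1).prod (isCompact_uIcc (a := a) (b := b)))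
    |>.exists_bound_of_continuousOn hF'.continuousOn
  exact intervalIntegral.hasFDerivAt_integral_of_dominated_of_fderiv_le (bound := fun _ => C)
    (Metric.ball_mem_nhds p one_pos)
    (Eventually.of_forall fun q => (hF q).aestronglyMeasurable)
    ((hF p).intervalIntegrable a b)
    (hF'.comp (Continuous.prodMk_right p)).aestronglyMeasurable
    (ae_of_all _ fun s hs q hq => hC (q, s) ⟨Metric.ball_subset_closedBall hq, uIoc_subset_uIcc hs⟩)
    intervalIntegrable_const
    (ae_of_all _ fun s _ q _ => hderiv q s)

theorem contDiff_deriv_of_infty {h : ℝ → ℝ} (hh : ContDiff ℝ ∞ h) : ContDiff ℝ ∞ (deriv h) :=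
  (contDiff_infty_iff_deriv.1 hh).2

/-- The integral of `h` over the interval of centre `t` and radius `ρ`, where `p = (t, ρ)`, in the
coordinate `s ∈ [-1, 1]` and with weight `(1 - s ^ 2) ^ k`. Extended radially this is, up to a
constant, the mean of the plane waves `h (t + ⟪x, ω⟫)` over the unit sphere of `ℝ ^ (2 * k + 3)`. -/
noncomputable def weightedMean (k : ℕ) (h : ℝ → ℝ) (p : ℝ × ℝ) : ℝ :=
  ∫ s in (-1 : ℝ)..1, (1 - s ^ 2) ^ k * h (p.1 + p.2 * s)

variable {h : ℝ → ℝ}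

theorem hasDerivAt_comp_const_add_const_mul (hh : Differentiable ℝ h) (t ρ s : ℝ) :
    HasDerivAt (fun s => h (t + ρ * s)) (ρ * deriv h (t + ρ * s)) s := by
  simpa [mul_comm, Function.comp_def] using
    (hh (t + ρ * s)).hasDerivAt.comp s (((hasDerivAt_id s).const_mul ρ).const_add t)

theorem hasDerivAt_one_sub_sq_pow (k : ℕ) (s : ℝ) :
    HasDerivAt (fun s : ℝ => (1 - s ^ 2) ^ (k + 1)) (-(2 * (k + 1)) * ((1 - s ^ 2) ^ k * s)) s := by
  refine (((hasDerivAt_pow 2 s).const_sub 1).fun_pow (k + 1)).congr_deriv ?_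
  push_cast [Nat.add_sub_cancel]
  ring

theorem integral_one_sub_sq_pow_mul_id (k : ℕ) (hh : ContDiff ℝ 1 h) (t ρ : ℝ) :
    ∫ s in (-1 : ℝ)..1, (1 - s ^ 2) ^ k * h (t + ρ * s) * s =
      ρ / (2 * (k + 1)) * weightedMean (k + 1) (deriv h) (t, ρ) := by
  have hderiv : Continuous fun s => ρ * deriv h (t + ρ * s) :=
    continuous_const.mul ((hh.continuous_deriv le_rfl).comp (by fun_prop))
  have hparts := intervalIntegral.integral_mul_deriv_eq_deriv_mul (a := -1) (b := 1)
    (fun s _ => hasDerivAt_one_sub_sq_pow k s)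
    (fun s _ => hasDerivAt_comp_const_add_const_mul (hh.differentiable (by simp)) t ρ s)
    (Continuous.intervalIntegrable (by fun_prop) _ _) (hderiv.intervalIntegrable _ _)
  have hleft : weightedMean (k + 1) (deriv h) (t, ρ) * ρ =
      ∫ s in (-1 : ℝ)..1, (1 - s ^ 2) ^ (k + 1) * (ρ * deriv h (t + ρ * s)) := by
    rw [weightedMean, ← intervalIntegral.integral_mul_const]
    exact intervalIntegral.integral_congr fun s _ => by ring
  have hright : ∫ s in (-1 : ℝ)..1, -(2 * ((k : ℝ) + 1)) * ((1 - s ^ 2) ^ k * s) * h (t + ρ * s) =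
      -(2 * ((k : ℝ) + 1)) * ∫ s in (-1 : ℝ)..1, (1 - s ^ 2) ^ k * h (t + ρ * s) * s := by
    rw [← intervalIntegral.integral_const_mul]
    exact intervalIntegral.integral_congr fun s _ => by ring
  rw [← hleft, hright] at hparts
  norm_num at hparts
  rw [div_mul_eq_mul_div, eq_div_iff (by positivity)]
  linarith

theorem hasFDerivAt_weightedMean (k : ℕ) (hh : ContDiff ℝ 2 h) (p : ℝ × ℝ) :
    HasFDerivAt (weightedMean k h)
      (weightedMean k (deriv h) p • ContinuousLinearMap.fst ℝ ℝ ℝ +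
        (p.2 / (2 * (k + 1)) * weightedMean (k + 1) (deriv (deriv h)) p) •
          ContinuousLinearMap.snd ℝ ℝ ℝ) p := by
  have hh' : ContDiff ℝ 1 (deriv h) := hh.deriv'
  have hc := hh.continuous
  have hc' := hh'.continuous
  have hderiv : ∀ (q : ℝ × ℝ) (s : ℝ),
      HasFDerivAt (fun q : ℝ × ℝ => (1 - s ^ 2) ^ k * h (q.1 + q.2 * s))
        (((1 - s ^ 2) ^ k * deriv h (q.1 + q.2 * s)) •
          (ContinuousLinearMap.fst ℝ ℝ ℝ + s • ContinuousLinearMap.snd ℝ ℝ ℝ)) q := fun q s => by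
    have hline : HasFDerivAt (fun q : ℝ × ℝ => q.1 + q.2 * s)
        (ContinuousLinearMap.fst ℝ ℝ ℝ + s • ContinuousLinearMap.snd ℝ ℝ ℝ) q :=
      hasFDerivAt_fst.add (hasFDerivAt_snd.mul_const s)
    rw [← smul_smul]
    exact ((hh.differentiable (by simp) _).hasDerivAt.comp_hasFDerivAt q hline).const_mul _
  refine (hasFDerivAt_intervalIntegral_of_continuous (fun q => by fun_prop) (by fun_prop)
    hderiv (-1) 1 p).congr_fderiv ?_
  simp only [smul_add, smul_smul]
  rw [intervalIntegral.integral_add (Continuous.intervalIntegrable (by fun_prop) _ _)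
    (Continuous.intervalIntegrable (by fun_prop) _ _), intervalIntegral.integral_smul_const,
    intervalIntegral.integral_smul_const, integral_one_sub_sq_pow_mul_id k hh']
  rfl

theorem sq_mul_weightedMean_add_two (k : ℕ) (hh : ContDiff ℝ 2 h) (t ρ : ℝ) :
    ρ ^ 2 / (2 * (k + 2)) * weightedMean (k + 2) (deriv (deriv h)) (t, ρ) =
      2 * (k + 1) * weightedMean k h (t, ρ) - (2 * k + 3) * weightedMean (k + 1) h (t, ρ) := by
  have hh' : ContDiff ℝ 1 (deriv h) := hh.deriv'
  have hc := hh.continuous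
  have hc' := hh'.continuous
  have hweight : ∀ s : ℝ, HasDerivAt (fun s : ℝ => (1 - s ^ 2) ^ (k + 1) * s)
      ((2 * k + 3) * (1 - s ^ 2) ^ (k + 1) - 2 * (k + 1) * (1 - s ^ 2) ^ k) s := fun s => by
    refine ((hasDerivAt_one_sub_sq_pow k s).fun_mul (hasDerivAt_id' s)).congr_deriv ?_
    ring
  have hparts := intervalIntegral.integral_mul_deriv_eq_deriv_mul (a := -1) (b := 1)
    (fun s _ => hweight s)
    (fun s _ => hasDerivAt_comp_const_add_const_mul (hh.differentiable (by simp)) t ρ s)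
    (Continuous.intervalIntegrable (by fun_prop) _ _)
    (Continuous.intervalIntegrable (by fun_prop) _ _)
  have hleft : ∫ s in (-1 : ℝ)..1, (1 - s ^ 2) ^ (k + 1) * s * (ρ * deriv h (t + ρ * s)) =
      ρ ^ 2 / (2 * (k + 2)) * weightedMean (k + 2) (deriv (deriv h)) (t, ρ) := by
    have hid := integral_one_sub_sq_pow_mul_id (k + 1) hh' t ρ
    calc ∫ s in (-1 : ℝ)..1, (1 - s ^ 2) ^ (k + 1) * s * (ρ * deriv h (t + ρ * s))
        = ρ * ∫ s in (-1 : ℝ)..1, (1 - s ^ 2) ^ (k + 1) * deriv h (t + ρ * s) * s := by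
          rw [← intervalIntegral.integral_const_mul]
          exact intervalIntegral.integral_congr fun s _ => by ring
      _ = _ := by rw [hid]; push_cast; ring
  have hright : ∫ s in (-1 : ℝ)..1,
      ((2 * k + 3) * (1 - s ^ 2) ^ (k + 1) - 2 * (k + 1) * (1 - s ^ 2) ^ k) * h (t + ρ * s) =
      (2 * k + 3) * weightedMean (k + 1) h (t, ρ) - 2 * (k + 1) * weightedMean k h (t, ρ) := by
    simp only [weightedMean, ← intervalIntegral.integral_const_mul]
    rw [← intervalIntegral.integral_sub (Continuous.intervalIntegrable (by fun_prop) _ _)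
      (Continuous.intervalIntegrable (by fun_prop) _ _)]
    exact intervalIntegral.integral_congr fun s _ => by ring
  rw [hleft, hright] at hparts
  norm_num at hparts
  linarith

end WeightedMean

section RadialMean

theorem hasFDerivAt_comp_norm {E : Type*} [NormedAddCommGroup E] [InnerProductSpace ℝ E]
    {A : ℝ × ℝ → ℝ} {a b : ℝ} (p : ℝ × E)
    (hA : HasFDerivAt A (a • ContinuousLinearMap.fst ℝ ℝ ℝ +
      (‖p.2‖ * b) • ContinuousLinearMap.snd ℝ ℝ ℝ) (p.1, ‖p.2‖)) :
    HasFDerivAt (fun p : ℝ × E => A (p.1, ‖p.2‖))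
      (a • ContinuousLinearMap.fst ℝ ℝ E +
        b • (innerSL ℝ p.2 ∘L ContinuousLinearMap.snd ℝ ℝ E)) p := by
  rcases eq_or_ne p.2 0 with hx | hx
  · -- the norm is not differentiable at the origin, but there `A` has no linear term in the radius
    rw [hx] at hA ⊢
    rw [hasFDerivAt_iff_isLittleO_nhds_zero] at hA ⊢
    have hcont : Continuous fun q : ℝ × E => (q.1, ‖q.2‖) := by fun_prop
    refine ((hA.comp_tendsto (hcont.tendsto' 0 0 (by simp))).trans_isBigO
      (Asymptotics.isBigO_of_le _ fun q => by simp [Prod.norm_def])).congr_left fun q => ?_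
    simp [hx]
  · have hnorm : HasFDerivAt (fun x : E => ‖x‖) (‖p.2‖⁻¹ • innerSL ℝ p.2) p.2 := by
      have hsqrt := (hasStrictFDerivAt_norm_sq p.2).hasFDerivAt.sqrt
        (by positivity : ‖p.2‖ ^ 2 ≠ 0)
      simp only [Real.sqrt_sq (norm_nonneg _)] at hsqrt
      refine hsqrt.congr_fderiv ?_
      ext v
      simp only [one_div, mul_inv_rev, smul_apply, coe_innerSL_apply, nsmul_eq_mul, Nat.cast_ofNat,
        smul_eq_mul]
      field_simp
    have hpolar : HasFDerivAt (fun q : ℝ × E => (q.1, ‖q.2‖))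
        ((ContinuousLinearMap.fst ℝ ℝ E).prod
          ((‖p.2‖⁻¹ • innerSL ℝ p.2) ∘L ContinuousLinearMap.snd ℝ ℝ E)) p :=
      hasFDerivAt_fst.prodMk (hnorm.comp p hasFDerivAt_snd)
    refine (hA.comp p hpolar).congr_fderiv ?_
    have hne : ‖p.2‖ ≠ 0 := norm_ne_zero_iff.2 hx
    ext v
    · simp
    · simp
      field_simp

variable {E : Type*} [NormedAddCommGroup E]

/-- The radial extension of `weightedMean` to space-time. -/
noncomputable def radialMean (k : ℕ) (h : ℝ → ℝ) (p : ℝ × E) : ℝ :=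
  weightedMean k h (p.1, ‖p.2‖)

variable [InnerProductSpace ℝ E] {h : ℝ → ℝ}

theorem hasFDerivAt_radialMean (k : ℕ) (hh : ContDiff ℝ 2 h) (p : ℝ × E) :
    HasFDerivAt (radialMean k h)
      (radialMean k (deriv h) p • ContinuousLinearMap.fst ℝ ℝ E +
        ((2 * ((k : ℝ) + 1))⁻¹ * radialMean (k + 1) (deriv (deriv h)) p) •
          (innerSL ℝ p.2 ∘L ContinuousLinearMap.snd ℝ ℝ E)) p := by
  refine hasFDerivAt_comp_norm p ?_
  convert hasFDerivAt_weightedMean k hh (p.1, ‖p.2‖) using 3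
  · rfl
  · rw [radialMean]
    ring

theorem contDiff_radialMean (k : ℕ) (hh : ContDiff ℝ ∞ h) :
    ContDiff ℝ ∞ (radialMean k h : ℝ × E → ℝ) := by
  rw [contDiff_infty]
  intro n
  induction n generalizing k h with
  | zero =>
    exact contDiff_zero.2 <| continuous_iff_continuousAt.2 fun p =>
      (hasFDerivAt_radialMean k (hh.of_le (WithTop.coe_le_coe.2 le_top)) p).continuousAt
  | succ n ih =>
    have hh' := contDiff_deriv_of_infty hh
    rw [Nat.cast_add, Nat.cast_one, contDiff_succ_iff_hasFDerivAt]
    refine ⟨_, ?_, hasFDerivAt_radialMean k (hh.of_le (WithTop.coe_le_coe.2 le_top))⟩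
    exact ((ih k hh').smul contDiff_const).add
      ((contDiff_const.mul (ih (k + 1) (contDiff_deriv_of_infty hh'))).smul
        (((innerSL ℝ).contDiff.comp contDiff_snd).clm_comp contDiff_const))

theorem dirDeriv_timeDir_radialMean (k : ℕ) (hh : ContDiff ℝ 2 h) :
    dirDeriv timeDir (radialMean k h : ℝ × E → ℝ) = radialMean k (deriv h) := by
  ext p
  rw [dirDeriv, (hasFDerivAt_radialMean k hh p).fderiv]
  simp [timeDir]

variable [FiniteDimensional ℝ E]

theorem dirDeriv_spaceDir_radialMean (k : ℕ) (hh : ContDiff ℝ 2 h)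
    (i : Fin (Module.finrank ℝ E)) :
    dirDeriv (spaceDir i) (radialMean k h) = fun p : ℝ × E => (2 * ((k : ℝ) + 1))⁻¹ *
      (radialMean (k + 1) (deriv (deriv h)) p * inner ℝ (stdOrthonormalBasis ℝ E i) p.2) := by
  ext p
  rw [dirDeriv, (hasFDerivAt_radialMean k hh p).fderiv]
  simp [spaceDir, mul_assoc, real_inner_comm]

theorem sum_dirDeriv_spaceDir_dirDeriv_spaceDir_radialMean (k : ℕ) (hh : ContDiff ℝ ∞ h)
    (p : ℝ × E) :
    ∑ i, dirDeriv (spaceDir i) (dirDeriv (spaceDir i) (radialMean k h)) p =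
      (2 * ((k : ℝ) + 1))⁻¹ * (Module.finrank ℝ E * radialMean (k + 1) (deriv (deriv h)) p +
        ‖p.2‖ ^ 2 / (2 * (k + 2)) *
          radialMean (k + 2) (deriv (deriv (deriv (deriv h)))) p) := by
  have hh'' := contDiff_deriv_of_infty (contDiff_deriv_of_infty hh)
  have hR : Differentiable ℝ (radialMean (k + 1) (deriv (deriv h)) : ℝ × E → ℝ) :=
    (contDiff_radialMean (k + 1) hh'').differentiable (by simp)
  have hcoord : ∀ (i) (q : ℝ × E), HasFDerivAt
      (fun q : ℝ × E => inner ℝ (stdOrthonormalBasis ℝ E i) q.2)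
      (innerSL ℝ (stdOrthonormalBasis ℝ E i) ∘L ContinuousLinearMap.snd ℝ ℝ E) q := fun i q =>
    (innerSL ℝ (stdOrthonormalBasis ℝ E i)).hasFDerivAt.comp q hasFDerivAt_snd
  have hsnd : ∀ i, dirDeriv (spaceDir i) (dirDeriv (spaceDir i) (radialMean k h)) p =
      (2 * ((k : ℝ) + 1))⁻¹ * (radialMean (k + 1) (deriv (deriv h)) p +
        (2 * ((k : ℝ) + 2))⁻¹ * radialMean (k + 2) (deriv (deriv (deriv (deriv h)))) p *
          inner ℝ (stdOrthonormalBasis ℝ E i) p.2 ^ 2) := fun i => by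
    have hone : dirDeriv (spaceDir i)
        (fun q : ℝ × E => inner ℝ (stdOrthonormalBasis ℝ E i) q.2) p = 1 := by
      rw [dirDeriv, (hcoord i p).fderiv]
      simp [spaceDir]
    rw [dirDeriv_spaceDir_radialMean k (hh.of_le (WithTop.coe_le_coe.2 le_top)),
      dirDeriv_const_mul ((hR p).fun_mul (hcoord i p).differentiableAt),
      dirDeriv_mul (hR p) (hcoord i p).differentiableAt, hone,
      dirDeriv_spaceDir_radialMean (k + 1) (hh''.of_le (WithTop.coe_le_coe.2 le_top))]
    push_cast
    ring
  simp only [hsnd]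
  rw [← Finset.mul_sum, Finset.sum_add_distrib, ← Finset.mul_sum,
    (stdOrthonormalBasis ℝ E).sum_sq_inner_right p.2]
  simp only [Finset.sum_const, Finset.card_univ, Fintype.card_fin, nsmul_eq_mul]
  field_simp

theorem isLinearWave_radialMean {k : ℕ} (hE : Module.finrank ℝ E = 2 * k + 3)
    (hh : ContDiff ℝ ∞ h) : IsLinearWave (radialMean k h : ℝ × E → ℝ) where
  smooth := contDiff_radialMean k hh
  equation p := by
    have hh' := contDiff_deriv_of_infty hh
    have hh'' := contDiff_deriv_of_infty hh'
    have hrec := sq_mul_weightedMean_add_two k (hh''.of_le (WithTop.coe_le_coe.2 le_top))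
      p.1 ‖p.2‖
    rw [dAlembertian, sum_dirDeriv_spaceDir_dirDeriv_spaceDir_radialMean k hh,
      dirDeriv_timeDir_radialMean k (hh.of_le (WithTop.coe_le_coe.2 le_top)),
      dirDeriv_timeDir_radialMean k (hh'.of_le (WithTop.coe_le_coe.2 le_top)), hE]
    simp only [radialMean, hrec]
    push_cast
    field_simp
    ring

end RadialMean

section RadialIntegrals

theorem lintegral_comp_norm {E : Type*} [NormedAddCommGroup E] [NormedSpace ℝ E]
    [FiniteDimensional ℝ E] [Nontrivial E] [MeasurableSpace E] [BorelSpace E]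
    (μ : Measure E) [μ.IsAddHaarMeasure] {F : ℝ → ℝ≥0∞} (hF : Measurable F) :
    ∫⁻ x, F ‖x‖ ∂μ = Module.finrank ℝ E * μ (Metric.ball 0 1) *
      ∫⁻ r in Ioi (0 : ℝ), ENNReal.ofReal (r ^ (Module.finrank ℝ E - 1)) * F r := by
  calc ∫⁻ x, F ‖x‖ ∂μ
      = ∫⁻ x : ({0}ᶜ : Set E), F ‖(x : E)‖ ∂μ.comap Subtype.val := by
        rw [lintegral_subtype_comap (measurableSet_singleton _).compl fun x : E => F ‖x‖,
          restrict_compl_singleton]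
    _ = ∫⁻ q : Metric.sphere (0 : E) 1 × Ioi (0 : ℝ), F q.2
          ∂μ.toSphere.prod (.volumeIoiPow (Module.finrank ℝ E - 1)) := by
        simpa using μ.measurePreserving_homeomorphUnitSphereProd.lintegral_comp_emb
          (Homeomorph.measurableEmbedding _) (F ∘ Subtype.val ∘ Prod.snd)
    _ = μ.toSphere univ * ∫⁻ r : Ioi (0 : ℝ), F r ∂.volumeIoiPow (Module.finrank ℝ E - 1) := by
        rw [lintegral_prod _ (by fun_prop)]
        simp only [lintegral_const]
        rw [mul_comm]
    _ = _ := by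
        rw [Measure.toSphere_apply_univ, Measure.volumeIoiPow,
          lintegral_withDensity_eq_lintegral_mul _ (by fun_prop) (by fun_prop)]
        simp only [Pi.mul_apply]
        rw [lintegral_subtype_comap measurableSet_Ioi
          fun r : ℝ => ENNReal.ofReal (r ^ (Module.finrank ℝ E - 1)) * F r]

theorem setLIntegral_sq_mul_le_lintegral_comp_norm {F : ℝ → ℝ≥0∞} (hF : Measurable F) :
    ∫⁻ r in Ioi (0 : ℝ), ENNReal.ofReal (r ^ 2) * F r ≤ ∫⁻ x : E3, F ‖x‖ := by
  have hsphere : 1 ≤ 3 * volume (Metric.ball (0 : E3) 1) := by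
    rw [EuclideanSpace.volume_ball_fin_three, ENNReal.ofReal_one, one_pow, one_mul,
      show (3 : ℝ≥0∞) = ENNReal.ofReal 3 by simp, ← ENNReal.ofReal_mul (by norm_num),
      ENNReal.one_le_ofReal]
    linarith [Real.pi_gt_three]
  rw [lintegral_comp_norm volume hF, finrank_euclideanSpace_fin]
  exact le_mul_of_one_le_left zero_le hsphere

theorem lintegral_of_even {F : ℝ → ℝ≥0∞} (heven : Function.Even F) :
    ∫⁻ s, F s = 2 * ∫⁻ s in Ioi (0 : ℝ), F s := by
  have hreflect := (Measure.measurePreserving_neg volume).setLIntegral_comp_preimage_emb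
    (Homeomorph.neg ℝ).measurableEmbedding F (Iio 0)
  have hIic : ∫⁻ s in Iic (0 : ℝ), F s = ∫⁻ s in Ioi (0 : ℝ), F s := by
    rw [setLIntegral_congr Iio_ae_eq_Iic.symm, ← hreflect]
    simp [heven _]
  rw [← lintegral_add_compl F (measurableSet_Iic (a := (0 : ℝ))), compl_Iic, hIic, two_mul]

theorem intervalIntegral_of_odd {g : ℝ → ℝ} (hodd : Function.Odd g) (a : ℝ) :
    ∫ s in (-a)..a, g s = 0 := by
  have hreflect := intervalIntegral.integral_comp_neg (a := -a) (b := a) g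
  simp only [hodd _, intervalIntegral.integral_neg, neg_neg] at hreflect
  linarith

theorem odd_deriv_of_even {f : ℝ → ℝ} (heven : Function.Even f) : Function.Odd (deriv f) :=
  fun s => by
    have hreflect := deriv_comp_neg f s
    simp only [heven _] at hreflect
    linarith

end RadialIntegrals

section Profile

/-- The profile of a function along the first coordinate axis, which determines the function if it
is radial. -/
noncomputable def profile (f : E3 → ℝ) (s : ℝ) : ℝ := f (s • EuclideanSpace.single 0 1)

variable {f : E3 → ℝ}

theorem contDiff_profile (hf : ContDiff ℝ ∞ f) : ContDiff ℝ ∞ (profile f) :=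
  hf.comp (contDiff_id.smul contDiff_const)

namespace IsRadial

theorem profile_eq (hr : IsRadial f) {s : ℝ} {x : E3} (h : |s| = ‖x‖) : profile f s = f x :=
  hr _ _ (by simp [norm_smul, h])

theorem profile_norm (hr : IsRadial f) (x : E3) : profile f ‖x‖ = f x :=
  hr.profile_eq (abs_norm x)

theorem even_profile (hr : IsRadial f) : Function.Even (profile f) := fun _ => hr _ _ (by simp)

theorem deriv_profile_norm (hr : IsRadial f) (hf : Differentiable ℝ f) {x : E3} (hx : x ≠ 0) :
    deriv (profile f) ‖x‖ = radialDeriv f x := by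
  have hx' : ‖x‖ ≠ 0 := norm_ne_zero_iff.2 hx
  have hray : HasDerivAt (fun s : ℝ => s • (‖x‖⁻¹ • x)) (‖x‖⁻¹ • x) ‖x‖ := by
    simpa using (hasDerivAt_id ‖x‖).smul_const (‖x‖⁻¹ • x)
  have hfx : HasFDerivAt f (fderiv ℝ f x) (‖x‖ • (‖x‖⁻¹ • x)) := by
    rw [smul_inv_smul₀ hx']
    exact (hf x).hasFDerivAt
  have hprofile : profile f = fun s : ℝ => f (s • (‖x‖⁻¹ • x)) := by
    ext s
    refine hr.profile_eq ?_
    rw [norm_smul, norm_smul, norm_inv, norm_norm, inv_mul_cancel₀ hx', mul_one, Real.norm_eq_abs]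
  rw [hprofile]
  exact (hfx.comp_hasDerivAt ‖x‖ hray).deriv

end IsRadial

theorem abs_radialDeriv_le (f : E3 → ℝ) {x : E3} (hx : x ≠ 0) : |radialDeriv f x| ≤ ‖∇ f x‖ := by
  calc |radialDeriv f x| = |inner ℝ (∇ f x) (‖x‖⁻¹ • x)| := by
        rw [gradient, InnerProductSpace.toDual_symm_apply, radialDeriv]
    _ ≤ ‖∇ f x‖ * ‖‖x‖⁻¹ • x‖ := abs_real_inner_le_norm _ _
    _ = ‖∇ f x‖ := by
        rw [norm_smul, norm_inv, norm_norm, inv_mul_cancel₀ (norm_ne_zero_iff.2 hx), mul_one]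

end Profile

section IntervalMean

variable {h : ℝ → ℝ}

theorem mul_weightedMean_zero (h : ℝ → ℝ) (t ρ : ℝ) :
    ρ * weightedMean 0 h (t, ρ) = ∫ s in (t - ρ)..(t + ρ), h s := by
  simp only [weightedMean, pow_zero, one_mul, intervalIntegral.mul_integral_comp_add_mul]
  congr 1 <;> ring

theorem le_half_weightedMean_zero (hc : Continuous h) {m : ℝ} (hm : ∀ s, m ≤ h s) (p : ℝ × ℝ) :
    m ≤ 2⁻¹ * weightedMean 0 h p := by
  have hmono : ∫ _ in (-1 : ℝ)..1, m ≤ ∫ s in (-1 : ℝ)..1, h (p.1 + p.2 * s) :=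
    intervalIntegral.integral_mono_on (by norm_num) intervalIntegrable_const
      (Continuous.intervalIntegrable (by fun_prop) _ _) fun s _ => hm _
  rw [intervalIntegral.integral_const, smul_eq_mul] at hmono
  simp only [weightedMean, pow_zero, one_mul]
  linarith

theorem half_weightedMean_zero_sub_one (hc : Continuous h) (p : ℝ × ℝ) :
    2⁻¹ * weightedMean 0 h p - 1 = 2⁻¹ * weightedMean 0 (fun s => h s - 1) p := by
  simp only [weightedMean, pow_zero, one_mul]
  rw [intervalIntegral.integral_sub (Continuous.intervalIntegrable (by fun_prop) _ _)
    intervalIntegrable_const, intervalIntegral.integral_const, smul_eq_mul]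
  ring

theorem enorm_half_weightedMean_zero_le_maximalFunction (g : ℝ → ℝ) {t ρ y : ℝ}
    (hy : y ∈ Metric.ball t ρ) :
    ‖2⁻¹ * weightedMean 0 g (t, ρ)‖ₑ ≤ maximalFunction volume (fun s => ‖g s‖ₑ) y := by
  refine le_trans ?_ (setLAverage_le_maximalFunction _ hy)
  have hρ : 0 < ρ := Metric.pos_of_mem_ball hy
  rw [setLAverage_eq, Real.volume_ball,
    ENNReal.le_div_iff_mul_le (Or.inl (by simpa using hρ)) (Or.inl ENNReal.ofReal_ne_top)]
  calc ‖2⁻¹ * weightedMean 0 g (t, ρ)‖ₑ * ENNReal.ofReal (2 * ρ)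
      = ‖∫ s in (t - ρ)..(t + ρ), g s‖ₑ := by
        rw [← mul_weightedMean_zero, ← Real.enorm_of_nonneg (by positivity : 0 ≤ 2 * ρ),
          ← enorm_mul]
        congr 1; ring
    _ ≤ ∫⁻ s in Metric.ball t ρ, ‖g s‖ₑ := by
        rw [intervalIntegral.integral_of_le (by linarith), integral_Ioc_eq_integral_Ioo,
          Real.ball_eq_Ioo]
        exact enorm_integral_le_lintegral_enorm _

end IntervalMean

section WaveProfile

/-- The profile of the incoming wave with radial data `v₀, v₁`: the radial solution of the wave
equation on `ℝ × ℝ³` is its mean over `[t - |x|, t + |x|]`. -/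
noncomputable def waveProfile (v₀ v₁ : E3 → ℝ) (s : ℝ) : ℝ :=
  profile v₀ s + s * deriv (profile v₀) s + s * profile v₁ s

variable {v₀ v₁ : E3 → ℝ}

theorem contDiff_waveProfile (h₀ : ContDiff ℝ ∞ v₀) (h₁ : ContDiff ℝ ∞ v₁) :
    ContDiff ℝ ∞ (waveProfile v₀ v₁) :=
  ((contDiff_profile h₀).add (contDiff_id.mul (contDiff_deriv_of_infty (contDiff_profile h₀)))).add
    (contDiff_id.mul (contDiff_profile h₁))

theorem half_radialMean_zero_eq_of_integral {E : Type*} [NormedAddCommGroup E]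
    [InnerProductSpace ℝ E] [Nontrivial E] {h : ℝ → ℝ} {f : E → ℝ} (hh : ContDiff ℝ ∞ h)
    (hf : Continuous f) (hint : ∀ x, ∫ s in (-‖x‖)..‖x‖, h s = 2 * (‖x‖ * f x)) (x : E) :
    2⁻¹ * radialMean 0 h (0, x) = f x := by
  have hcont : Continuous fun x : E => 2⁻¹ * radialMean 0 h (0, x) :=
    continuous_const.mul ((contDiff_radialMean 0 hh).continuous.comp (by fun_prop))
  refine congrFun (hcont.ext_on (dense_compl_singleton (0 : E)) hf fun x hx => ?_) x
  refine mul_left_cancel₀ (norm_ne_zero_iff.2 hx) ?_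
  have hmean := mul_weightedMean_zero h 0 ‖x‖
  rw [zero_sub, zero_add, hint] at hmean
  simp only [radialMean]
  linarith

theorem half_radialMean_waveProfile (h₀ : ContDiff ℝ ∞ v₀) (h₁ : ContDiff ℝ ∞ v₁)
    (hr₀ : IsRadial v₀) (hr₁ : IsRadial v₁) (x : E3) :
    2⁻¹ * radialMean 0 (waveProfile v₀ v₁) (0, x) = v₀ x := by
  refine half_radialMean_zero_eq_of_integral (contDiff_waveProfile h₀ h₁) h₀.continuous
    (fun x => ?_) x
  have hp₀ := contDiff_profile h₀
  have hc₀ := hp₀.continuous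
  have hc₁ := (contDiff_profile h₁).continuous
  have hderiv : ∀ s, HasDerivAt (fun s => s * profile v₀ s)
      (profile v₀ s + s * deriv (profile v₀) s) s := fun s => by
    simpa using (hasDerivAt_id s).fun_mul (hp₀.differentiable (by simp) s).hasDerivAt
  have hodd : ∫ s in (-‖x‖)..‖x‖, s * profile v₁ s = 0 :=
    intervalIntegral_of_odd (fun s => by rw [hr₁.even_profile, neg_mul]) _
  simp only [waveProfile]
  rw [intervalIntegral.integral_add (Continuous.intervalIntegrable (by fun_prop) _ _)
    (Continuous.intervalIntegrable (by fun_prop) _ _), hodd,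
    intervalIntegral.integral_eq_sub_of_hasDerivAt (fun s _ => hderiv s)
      (Continuous.intervalIntegrable (by fun_prop) _ _), hr₀.even_profile, hr₀.profile_norm]
  ring

theorem half_radialMean_deriv_waveProfile (h₀ : ContDiff ℝ ∞ v₀) (h₁ : ContDiff ℝ ∞ v₁)
    (hr₀ : IsRadial v₀) (hr₁ : IsRadial v₁) (x : E3) :
    2⁻¹ * radialMean 0 (deriv (waveProfile v₀ v₁)) (0, x) = v₁ x := by
  have hh := contDiff_waveProfile h₀ h₁
  have hh' := contDiff_deriv_of_infty hh
  refine half_radialMean_zero_eq_of_integral hh' h₁.continuous (fun x => ?_) x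
  rw [intervalIntegral.integral_deriv_eq_sub (fun s _ => hh.differentiable (by simp) s)
    (hh'.continuous.intervalIntegrable _ _)]
  simp only [waveProfile, hr₀.even_profile _, odd_deriv_of_even hr₀.even_profile _,
    hr₁.even_profile _, hr₁.profile_norm]
  ring

end WaveProfile

section SquareIntegrableProfile

theorem lintegral_maximalFunction_sq_le {g : ℝ → ℝ≥0∞} (hg : Measurable g) :
    ∫⁻ y, maximalFunction volume g y ^ 2 ≤ 40 * ∫⁻ y, g y ^ 2 := by
  have h := lintegral_maximalFunction_rpow_le (μ := volume) one_lt_two hg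
  simp only [ENNReal.rpow_ofNat, Module.finrank_self, pow_one] at h
  refine h.trans_eq ?_
  norm_num

variable {g : ℝ → ℝ}

theorem ofReal_mul_enorm_half_weightedMean_zero_sq_le (g : ℝ → ℝ) (t : ℝ) {r : ℝ} (hr : 0 < r) :
    ENNReal.ofReal r * ‖2⁻¹ * weightedMean 0 g (t, r)‖ₑ ^ 2 ≤
      ∫⁻ y, maximalFunction volume (fun s => ‖g s‖ₑ) y ^ 2 := by
  calc ENNReal.ofReal r * ‖2⁻¹ * weightedMean 0 g (t, r)‖ₑ ^ 2
      ≤ ENNReal.ofReal (2 * r) * ‖2⁻¹ * weightedMean 0 g (t, r)‖ₑ ^ 2 := by gcongr; linarith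
    _ = ∫⁻ y in Metric.ball t r, ‖2⁻¹ * weightedMean 0 g (t, r)‖ₑ ^ 2 := by
        rw [setLIntegral_const, Real.volume_ball, mul_comm]
    _ ≤ ∫⁻ y in Metric.ball t r, maximalFunction volume (fun s => ‖g s‖ₑ) y ^ 2 :=
        setLIntegral_mono' Metric.isOpen_ball.measurableSet fun y hy => by
          gcongr; exact enorm_half_weightedMean_zero_le_maximalFunction g hy
    _ ≤ _ := setLIntegral_le_lintegral _ _

theorem setLIntegral_enorm_half_weightedMean_zero_sq_le (g : ℝ → ℝ) (t : ℝ) :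
    ∫⁻ r in Ioi (0 : ℝ), ‖2⁻¹ * weightedMean 0 g (t, r)‖ₑ ^ 2 ≤
      2 * ∫⁻ y, maximalFunction volume (fun s => ‖g s‖ₑ) y ^ 2 := by
  have hmem : ∀ r > 0, t + 2⁻¹ * r ∈ Metric.ball t r := fun r hr => by
    rw [Metric.mem_ball, Real.dist_eq, add_sub_cancel_left, abs_of_pos (by linarith)]
    linarith
  have hmeas : Measurable fun y => maximalFunction volume (fun s => ‖g s‖ₑ) y ^ 2 :=
    (lowerSemicontinuous_maximalFunction _).measurable.pow_const 2
  calc ∫⁻ r in Ioi (0 : ℝ), ‖2⁻¹ * weightedMean 0 g (t, r)‖ₑ ^ 2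
      ≤ ∫⁻ r in Ioi (0 : ℝ), maximalFunction volume (fun s => ‖g s‖ₑ) (t + 2⁻¹ * r) ^ 2 :=
        setLIntegral_mono' measurableSet_Ioi fun r hr => by
          gcongr; exact enorm_half_weightedMean_zero_le_maximalFunction g (hmem r hr)
    _ ≤ ∫⁻ r, maximalFunction volume (fun s => ‖g s‖ₑ) (t + 2⁻¹ * r) ^ 2 :=
        setLIntegral_le_lintegral _ _
    _ = ∫⁻ y, maximalFunction volume (fun s => ‖g s‖ₑ) (t + y) ^ 2
          ∂(volume.map fun r : ℝ => 2⁻¹ * r) :=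
        (lintegral_map (hmeas.comp (measurable_const_add t)) (measurable_const_mul _)).symm
    _ = _ := by
        rw [Real.map_volume_mul_left (by norm_num), lintegral_smul_measure,
          lintegral_add_left_eq_self
            (fun y => maximalFunction volume (fun s => ‖g s‖ₑ) y ^ 2) t]
        norm_num

theorem lintegral_enorm_half_radialMean_zero_pow_six_lt_top (hg : Continuous g)
    (hg2 : ∫⁻ s, ‖g s‖ₑ ^ 2 < ⊤) (t : ℝ) :
    ∫⁻ x : E3, ‖2⁻¹ * radialMean 0 g (t, x)‖ₑ ^ 6 < ⊤ := by
  let W : ℝ → ℝ≥0∞ := fun r => ‖2⁻¹ * weightedMean 0 g (t, r)‖ₑ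
  let K : ℝ≥0∞ := ∫⁻ y, maximalFunction volume (fun s => ‖g s‖ₑ) y ^ 2
  have hW : Measurable W := by
    have hmean : Continuous fun r => weightedMean 0 g (t, r) :=
      intervalIntegral.continuous_parametric_intervalIntegral_of_continuous' (by fun_prop) _ _
    fun_prop
  have hK : K < ⊤ := (lintegral_maximalFunction_sq_le (by fun_prop)).trans_lt
    (ENNReal.mul_lt_top (by simp) hg2)
  have hradial : ∫⁻ r in Ioi (0 : ℝ), ENNReal.ofReal (r ^ 2) * W r ^ 6 < ⊤ :=
    calc ∫⁻ r in Ioi (0 : ℝ), ENNReal.ofReal (r ^ 2) * W r ^ 6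
        ≤ ∫⁻ r in Ioi (0 : ℝ), K ^ 2 * W r ^ 2 := by
          refine setLIntegral_mono' measurableSet_Ioi fun r (hr : 0 < r) => ?_
          calc ENNReal.ofReal (r ^ 2) * W r ^ 6 = (ENNReal.ofReal r * W r ^ 2) ^ 2 * W r ^ 2 := by
                rw [ENNReal.ofReal_pow hr.le]; ring
            _ ≤ K ^ 2 * W r ^ 2 := by
                gcongr; exact ofReal_mul_enorm_half_weightedMean_zero_sq_le g t hr
      _ = K ^ 2 * ∫⁻ r in Ioi (0 : ℝ), W r ^ 2 := lintegral_const_mul _ (by fun_prop)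
      _ ≤ K ^ 2 * (2 * K) := by
          gcongr; exact setLIntegral_enorm_half_weightedMean_zero_sq_le g t
      _ < ⊤ := by finiteness
  change ∫⁻ x : E3, W ‖x‖ ^ 6 < ⊤
  rw [lintegral_comp_norm volume (hW.pow_const 6), finrank_euclideanSpace_fin]
  exact ENNReal.mul_lt_top (by finiteness) hradial

end SquareIntegrableProfile

section EnergyOfProfile

theorem setLIntegral_Ioi_le_of_frequently {F : ℝ → ℝ≥0∞} (hF : Measurable F) {a : ℝ} {B : ℝ≥0∞}
    (h : ∃ᶠ R in atTop, ∫⁻ s in Ioc a R, F s ≤ B) : ∫⁻ s in Ioi a, F s ≤ B := by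
  have hcover : AECover (volume.restrict (Ioi a)) atTop fun R : ℝ => Iic R :=
    (aecover_Iic tendsto_id).restrict
  refine le_of_tendsto_of_frequently
    (hcover.lintegral_tendsto_of_countably_generated hF.aemeasurable) (h.mono fun R hR => ?_)
  rwa [Measure.restrict_restrict measurableSet_Iic, inter_comm, Ioi_inter_Iic]

theorem setLIntegral_Ioc_ofReal {F : ℝ → ℝ} (hF : Continuous F) (hF0 : ∀ s, 0 ≤ F s) {a b : ℝ}
    (hab : a ≤ b) :
    ∫⁻ s in Ioc a b, ENNReal.ofReal (F s) = ENNReal.ofReal (∫ s in a..b, F s) := by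
  rw [intervalIntegral.integral_of_le hab, ofReal_integral_eq_lintegral_ofReal
    (hF.integrableOn_Icc.mono_set Ioc_subset_Icc_self) (ae_of_all _ hF0)]

theorem integral_deriv_mul_sq {q : ℝ → ℝ} (hq : ContDiff ℝ 1 q) (R : ℝ) :
    ∫ s in (0 : ℝ)..R, (q s + s * deriv q s) ^ 2 =
      (∫ s in (0 : ℝ)..R, (s * deriv q s) ^ 2) + R * q R ^ 2 := by
  have hc := hq.continuous
  have hderiv : ∀ s, HasDerivAt (fun s => s * q s ^ 2)
      (q s ^ 2 + s * (2 * q s * deriv q s)) s := fun s => by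
    simpa using
      (hasDerivAt_id s).fun_mul ((hq.differentiable (by simp) s).hasDerivAt.fun_pow 2)
  have hboundary : R * q R ^ 2 = ∫ s in (0 : ℝ)..R, q s ^ 2 + s * (2 * q s * deriv q s) := by
    rw [intervalIntegral.integral_eq_sub_of_hasDerivAt (fun s _ => hderiv s)
      (Continuous.intervalIntegrable (by fun_prop) _ _)]
    ring
  rw [hboundary, ← intervalIntegral.integral_add (Continuous.intervalIntegrable (by fun_prop) _ _)
    (Continuous.intervalIntegrable (by fun_prop) _ _)]
  exact intervalIntegral.integral_congr fun s _ => by ring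

theorem setLIntegral_deriv_mul_sq_le {q : ℝ → ℝ} (hq : ContDiff ℝ 1 q)
    (hdecay : ∀ δ > 0, ∃ᶠ R in atTop, R * q R ^ 2 ≤ δ) :
    ∫⁻ s in Ioi (0 : ℝ), ENNReal.ofReal ((q s + s * deriv q s) ^ 2) ≤
      ∫⁻ s in Ioi (0 : ℝ), ENNReal.ofReal ((s * deriv q s) ^ 2) := by
  have hc := hq.continuous
  refine ENNReal.le_of_forall_pos_le_add fun δ hδ _ =>
    setLIntegral_Ioi_le_of_frequently (by fun_prop) ?_
  refine ((hdecay δ hδ).and_eventually (eventually_ge_atTop 0)).mono fun R ⟨hRδ, hR⟩ => ?_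
  rw [setLIntegral_Ioc_ofReal (by fun_prop) (fun s => sq_nonneg _) hR, integral_deriv_mul_sq hq,
    ENNReal.ofReal_add (intervalIntegral.integral_nonneg hR fun s _ => sq_nonneg _)
      (by positivity), ← setLIntegral_Ioc_ofReal (by fun_prop) (fun s => sq_nonneg _) hR,
    ← ENNReal.ofReal_coe_nnreal]
  exact add_le_add (lintegral_mono_set Ioc_subset_Ioi_self) (ENNReal.ofReal_le_ofReal hRδ)

theorem frequently_mul_sq_le_of_lintegral_lt_top {q : ℝ → ℝ}
    (h6 : ∫⁻ r in Ioi (0 : ℝ), ENNReal.ofReal (r ^ 2) * ‖q r‖ₑ ^ 6 < ⊤) {δ : ℝ} (hδ : 0 < δ) :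
    ∃ᶠ R in atTop, R * q R ^ 2 ≤ δ := by
  -- otherwise `r ^ 2 * q ^ 6 ≥ δ ^ 3 / r` for large `r`, which is not integrable
  intro hlarge
  obtain ⟨N, hN⟩ := eventually_atTop.1 hlarge
  refine not_integrableOn_Ioi_inv (a := max N 1) ⟨measurable_inv.aestronglyMeasurable, ?_⟩
  have hpos : ∀ r ∈ Ioi (max N 1), 0 < r := fun r hr =>
    lt_trans one_pos ((le_max_right _ _).trans_lt hr)
  have hpt : ∀ r ∈ Ioi (max N 1),
      ENNReal.ofReal (δ ^ 3) * ‖r⁻¹‖ₑ ≤ ENNReal.ofReal (r ^ 2) * ‖q r‖ₑ ^ 6 := fun r hr => by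
    have hr0 := hpos r hr
    have hδr : δ < r * q r ^ 2 := not_le.1 (hN r ((le_max_left _ _).trans (le_of_lt hr)))
    rw [Real.enorm_of_nonneg (by positivity), ← ENNReal.ofReal_mul (by positivity),
      Real.enorm_eq_ofReal_abs, ← ENNReal.ofReal_pow (abs_nonneg _),
      ← ENNReal.ofReal_mul (by positivity), Even.pow_abs (by decide)]
    refine ENNReal.ofReal_le_ofReal ?_
    rw [← div_eq_mul_inv, div_le_iff₀ hr0]
    calc δ ^ 3 ≤ (r * q r ^ 2) ^ 3 := by gcongr
      _ = r ^ 2 * q r ^ 6 * r := by ring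
  have hfin : ENNReal.ofReal (δ ^ 3) * ∫⁻ r in Ioi (max N 1), ‖r⁻¹‖ₑ < ⊤ := by
    rw [← lintegral_const_mul' _ _ ENNReal.ofReal_ne_top]
    exact ((setLIntegral_mono' measurableSet_Ioi hpt).trans
      (lintegral_mono_set fun r hr => hpos r hr)).trans_lt h6
  exact (ENNReal.lt_top_of_mul_ne_top_right hfin.ne (by positivity))

variable {v₀ v₁ : E3 → ℝ}

theorem setLIntegral_mul_deriv_profile_sq_add_le (h₀ : ContDiff ℝ ∞ v₀) (h₁ : Continuous v₁)
    (hr₀ : IsRadial v₀) (hr₁ : IsRadial v₁) :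
    (∫⁻ s in Ioi (0 : ℝ), ENNReal.ofReal ((s * deriv (profile v₀) s) ^ 2)) +
        ∫⁻ s in Ioi (0 : ℝ), ENNReal.ofReal ((s * profile v₁ s) ^ 2) ≤
      ∫⁻ x, ENNReal.ofReal (v₁ x ^ 2 + ‖∇ v₀ x‖ ^ 2) := by
  have hc₁ : Continuous (profile v₁) := h₁.comp (by fun_prop)
  calc _ = ∫⁻ r in Ioi (0 : ℝ), ENNReal.ofReal (r ^ 2) *
        ENNReal.ofReal (profile v₁ r ^ 2 + deriv (profile v₀) r ^ 2) := by
        rw [← lintegral_add_left (by fun_prop)]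
        refine lintegral_congr fun r => ?_
        rw [← ENNReal.ofReal_add (by positivity) (by positivity),
          ← ENNReal.ofReal_mul (by positivity)]
        congr 1; ring
    _ ≤ ∫⁻ x : E3, ENNReal.ofReal (profile v₁ ‖x‖ ^ 2 + deriv (profile v₀) ‖x‖ ^ 2) :=
        setLIntegral_sq_mul_le_lintegral_comp_norm
          (F := fun r => ENNReal.ofReal (profile v₁ r ^ 2 + deriv (profile v₀) r ^ 2))
          (by fun_prop)
    _ ≤ _ := by
        refine lintegral_mono_ae ?_
        filter_upwards [compl_mem_ae_iff.2 (measure_singleton (0 : E3))] with x hx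
        rw [hr₁.profile_norm, hr₀.deriv_profile_norm (h₀.differentiable (by simp)) hx,
          ← sq_abs (radialDeriv v₀ x)]
        gcongr
        exact abs_radialDeriv_le v₀ hx

theorem enorm_waveProfile_sub_one_sq_le (v₀ v₁ : E3 → ℝ) (s : ℝ) :
    ‖waveProfile v₀ v₁ s - 1‖ₑ ^ 2 ≤
      2 * ENNReal.ofReal ((profile v₀ s - 1 + s * deriv (profile v₀) s) ^ 2) +
        2 * ENNReal.ofReal ((s * profile v₁ s) ^ 2) := by
  rw [show (2 : ℝ≥0∞) = ENNReal.ofReal 2 by simp, ← ENNReal.ofReal_mul (by norm_num),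
    ← ENNReal.ofReal_mul (by norm_num), ← ENNReal.ofReal_add (by positivity) (by positivity),
    Real.enorm_eq_ofReal_abs, ← ENNReal.ofReal_pow (abs_nonneg _), sq_abs, ← mul_add]
  refine ENNReal.ofReal_le_ofReal ((le_of_eq ?_).trans (add_sq_le ..))
  rw [waveProfile]
  ring

theorem lintegral_waveProfile_sub_one_sq_le (h₀ : ContDiff ℝ ∞ v₀) (h₁ : Continuous v₁)
    (hr₀ : IsRadial v₀) (hr₁ : IsRadial v₁) (h6 : ∫⁻ x, ‖v₀ x - 1‖ₑ ^ 6 < ⊤) :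
    ∫⁻ s, ‖waveProfile v₀ v₁ s - 1‖ₑ ^ 2 ≤
      4 * ∫⁻ x, ENNReal.ofReal (v₁ x ^ 2 + ‖∇ v₀ x‖ ^ 2) := by
  let q : ℝ → ℝ := fun s => profile v₀ s - 1
  have hq : ContDiff ℝ ∞ q := (contDiff_profile h₀).sub contDiff_const
  have hq' : deriv q = deriv (profile v₀) := deriv_sub_const_fun 1
  have hc := hq.continuous
  have hc₁ : Continuous (profile v₁) := h₁.comp (by fun_prop)
  have hradial : ∫⁻ r in Ioi (0 : ℝ), ENNReal.ofReal (r ^ 2) * ‖q r‖ₑ ^ 6 < ⊤ :=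
    (setLIntegral_sq_mul_le_lintegral_comp_norm (F := fun r => ‖q r‖ₑ ^ 6)
      (by fun_prop)).trans_lt (by simpa only [q, hr₀.profile_norm] using h6)
  have hhalf := setLIntegral_deriv_mul_sq_le (hq.of_le (WithTop.coe_le_coe.2 le_top))
    fun δ hδ => frequently_mul_sq_le_of_lintegral_lt_top hradial hδ
  rw [hq'] at hhalf
  calc ∫⁻ s, ‖waveProfile v₀ v₁ s - 1‖ₑ ^ 2
      ≤ ∫⁻ s, (2 * ENNReal.ofReal ((q s + s * deriv (profile v₀) s) ^ 2) +
        2 * ENNReal.ofReal ((s * profile v₁ s) ^ 2)) :=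
        lintegral_mono (enorm_waveProfile_sub_one_sq_le v₀ v₁)
    _ = 2 * ∫⁻ s in Ioi (0 : ℝ), (2 * ENNReal.ofReal ((q s + s * deriv (profile v₀) s) ^ 2) +
        2 * ENNReal.ofReal ((s * profile v₁ s) ^ 2)) := by
        refine lintegral_of_even fun s => ?_
        simp only [q, hr₀.even_profile _, hr₁.even_profile _,
          odd_deriv_of_even hr₀.even_profile _, neg_mul_neg, neg_mul _ (profile _ _), neg_sq]
    _ = 4 * ((∫⁻ s in Ioi (0 : ℝ), ENNReal.ofReal ((q s + s * deriv (profile v₀) s) ^ 2)) +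
        ∫⁻ s in Ioi (0 : ℝ), ENNReal.ofReal ((s * profile v₁ s) ^ 2)) := by
        rw [lintegral_add_left (by fun_prop), lintegral_const_mul _ (by fun_prop),
          lintegral_const_mul _ (by fun_prop), ← mul_add, ← mul_assoc]
        norm_num
    _ ≤ 4 * ∫⁻ x, ENNReal.ofReal (v₁ x ^ 2 + ‖∇ v₀ x‖ ^ 2) := by
        gcongr
        exact (add_le_add_left hhalf _).trans
          (setLIntegral_mul_deriv_profile_sq_add_le h₀ h₁ hr₀ hr₁)

end EnergyOfProfile

section EnergyNorm

theorem rpow_half_le_iff {a b : ℝ≥0∞} : a ^ (1 / 2 : ℝ) ≤ b ↔ a ≤ b ^ 2 := by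
  rw [one_div, ENNReal.rpow_inv_le_iff two_pos, ENNReal.rpow_two]

theorem sq_eLpNorm_two {X F : Type*} [MeasurableSpace X] [NormedAddCommGroup F] (μ : Measure X)
    (f : X → F) : eLpNorm f 2 μ ^ 2 = ∫⁻ x, ‖f x‖ₑ ^ 2 ∂μ := by
  simpa using eLpNorm_nnreal_pow_eq_lintegral (μ := μ) (f := f) (p := 2) two_ne_zero

theorem memLp_six_iff {X F : Type*} [MeasurableSpace X] [NormedAddCommGroup F] {μ : Measure X}
    {f : X → F} (hf : AEStronglyMeasurable f μ) : MemLp f 6 μ ↔ ∫⁻ x, ‖f x‖ₑ ^ 6 ∂μ < ⊤ := by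
  simpa [MemLp, hf] using eLpNorm_lt_top_iff_lintegral_rpow_enorm_lt_top (μ := μ) (f := f)
    (p := 6) (by norm_num) (by norm_num)

theorem enorm_le_eLpNorm_top {X F : Type*} [TopologicalSpace X] [MeasurableSpace X]
    [NormedAddCommGroup F] {μ : Measure X} [μ.IsOpenPosMeasure] {f : X → F} (hf : Continuous f)
    (x : X) : ‖f x‖ₑ ≤ eLpNorm f ⊤ μ := by
  have hclosed : IsClosed {x | ‖f x‖ₑ ≤ eLpNorm f ⊤ μ} := isClosed_le hf.enorm continuous_const
  have hae : ∀ᵐ x ∂μ, ‖f x‖ₑ ≤ eLpNorm f ⊤ μ := by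
    simpa only [eLpNorm_exponent_top] using ae_le_eLpNormEssSup
  exact eq_univ_iff_forall.1 (hclosed.ae_eq_univ_iff_eq.1 (eventuallyEq_univ.2 hae)) x

theorem isBounded_range_of_memLp_top {X F : Type*} [TopologicalSpace X] [MeasurableSpace X]
    [NormedAddCommGroup F] {μ : Measure X} [μ.IsOpenPosMeasure] {f : X → F} (hf : Continuous f)
    (h : MemLp f ⊤ μ) : Bornology.IsBounded (range f) := by
  refine isBounded_iff_forall_norm_le.2 ⟨(eLpNorm f ⊤ μ).toReal, ?_⟩
  rintro _ ⟨x, rfl⟩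
  simpa using ENNReal.toReal_mono h.2.ne (enorm_le_eLpNorm_top hf x)

theorem measurable_gradient (f : E3 → ℝ) : Measurable (∇ f) :=
  (LinearIsometryEquiv.continuous _).measurable.comp (measurable_fderiv ℝ f)

theorem energyNorm_sq (f g : E3 → ℝ) :
    energyNorm f g ^ 2 = hDotNorm f ^ 2 + eLpNorm g 2 volume ^ 2 := by
  rw [energyNorm, ← ENNReal.rpow_two, ← ENNReal.rpow_mul]
  norm_num

theorem energyNorm_sq_eq_lintegral (f g : E3 → ℝ) :
    energyNorm f g ^ 2 = ∫⁻ x, ENNReal.ofReal (g x ^ 2 + ‖∇ f x‖ ^ 2) := by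
  have hgrad := measurable_gradient f
  rw [energyNorm_sq, hDotNorm, sq_eLpNorm_two, sq_eLpNorm_two, ← lintegral_add_left (by fun_prop)]
  refine lintegral_congr fun x => ?_
  rw [ENNReal.ofReal_add (by positivity) (by positivity), add_comm, ← ofReal_norm, ← ofReal_norm,
    ← ENNReal.ofReal_pow (norm_nonneg _), ← ENNReal.ofReal_pow (norm_nonneg _), Real.norm_eq_abs,
    sq_abs]

theorem hDotNorm_le_energyNorm (f g : E3 → ℝ) : hDotNorm f ≤ energyNorm f g :=
  (ENNReal.pow_le_pow_left_iff two_ne_zero).1 (le_self_add.trans_eq (energyNorm_sq f g).symm)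

theorem eLpNorm_le_energyNorm (f g : E3 → ℝ) : eLpNorm g 2 volume ≤ energyNorm f g :=
  (ENNReal.pow_le_pow_left_iff two_ne_zero).1 (le_add_self.trans_eq (energyNorm_sq f g).symm)

theorem energyNorm_lt_top {f g : E3 → ℝ} (hf : MemHDot f) (hg : MemLp g 2 volume) :
    energyNorm f g < ⊤ :=
  ENNReal.rpow_lt_top_of_nonneg (by norm_num)
    (ENNReal.add_lt_top.2 ⟨ENNReal.pow_lt_top hf.2.2, ENNReal.pow_lt_top hg.2⟩).ne

theorem energyNorm_le_mul {f g f' g' : E3 → ℝ} {c : ℝ} (hc : 0 ≤ c)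
    (h : ∀ x, g x ^ 2 + ‖∇ f x‖ ^ 2 ≤ c ^ 2 * (g' x ^ 2 + ‖∇ f' x‖ ^ 2)) :
    energyNorm f g ≤ ENNReal.ofReal c * energyNorm f' g' := by
  refine (ENNReal.pow_le_pow_left_iff two_ne_zero).1 ?_
  rw [mul_pow, energyNorm_sq_eq_lintegral, energyNorm_sq_eq_lintegral, ← ENNReal.ofReal_pow hc,
    ← lintegral_const_mul' _ _ ENNReal.ofReal_ne_top]
  refine lintegral_mono fun x => ?_
  rw [← ENNReal.ofReal_mul (by positivity)]
  exact ENNReal.ofReal_le_ofReal (h x)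

theorem IsLinearWave.energyNorm_slice_le {W : ℝ × E3 → ℝ} (hW : IsLinearWave W) (t : ℝ) :
    energyNorm (fun x => W (t, x)) (timeDeriv (fun t x => W (t, x)) t) ≤
      energyNorm (fun x => W (0, x)) (timeDeriv (fun t x => W (t, x)) 0) := by
  have hd : Differentiable ℝ W := hW.smooth.differentiable (by simp)
  refine (ENNReal.pow_le_pow_left_iff two_ne_zero).1 ?_
  simp only [energyNorm_sq_eq_lintegral, ← energyDensity_eq_timeDeriv_gradient hd]
  exact hW.lintegral_energyDensity_le t

end EnergyNorm

section LinearizedData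

theorem abs_exp_sub_one_le (y : ℝ) : |Real.exp y - 1| ≤ max 1 (Real.exp y) * |y| := by
  rcases le_total 0 y with hy | hy
  · rw [abs_of_nonneg hy, abs_of_nonneg (sub_nonneg.2 (Real.one_le_exp hy))]
    calc Real.exp y - 1 = Real.exp y * (1 - Real.exp (-y)) := by
          rw [mul_sub, ← Real.exp_add, add_neg_cancel, Real.exp_zero, mul_one]
      _ ≤ Real.exp y * y := by gcongr; linarith [Real.add_one_le_exp (-y)]
      _ ≤ max 1 (Real.exp y) * y := by gcongr; exact le_max_right _ _
  · rw [abs_of_nonpos hy, abs_of_nonpos (sub_nonpos.2 (Real.exp_le_one_iff.2 hy))]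
    calc -(Real.exp y - 1) ≤ 1 * -y := by linarith [Real.add_one_le_exp y]
      _ ≤ max 1 (Real.exp y) * -y := by gcongr; exacts [by linarith, le_max_left _ _]

theorem abs_le_mul_abs_exp_sub_one (y : ℝ) :
    |y| ≤ max 1 (Real.exp (-y)) * |Real.exp y - 1| := by
  rcases le_total 0 y with hy | hy
  · rw [abs_of_nonneg hy, abs_of_nonneg (sub_nonneg.2 (Real.one_le_exp hy))]
    calc y ≤ 1 * (Real.exp y - 1) := by linarith [Real.add_one_le_exp y]
      _ ≤ max 1 (Real.exp (-y)) * (Real.exp y - 1) := by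
          gcongr; exacts [sub_nonneg.2 (Real.one_le_exp hy), le_max_left _ _]
  · have hexp : 0 ≤ -(Real.exp y - 1) := by linarith [Real.exp_le_one_iff.2 hy]
    rw [abs_of_nonpos hy, abs_of_nonpos (neg_nonneg.1 hexp)]
    calc -y ≤ Real.exp (-y) - 1 := by linarith [Real.add_one_le_exp (-y)]
      _ = Real.exp (-y) * -(Real.exp y - 1) := by
          rw [mul_neg, mul_sub, ← Real.exp_add, neg_add_cancel, Real.exp_zero, mul_one, neg_sub]
      _ ≤ max 1 (Real.exp (-y)) * -(Real.exp y - 1) := by gcongr; exact le_max_right _ _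

theorem norm_gradient_exp_neg_sq {E : Type*} [NormedAddCommGroup E] [InnerProductSpace ℝ E]
    [FiniteDimensional ℝ E] {f : E → ℝ} (hf : Differentiable ℝ f) (x : E) :
    ‖∇ (fun y => Real.exp (-f y)) x‖ ^ 2 = Real.exp (-f x) ^ 2 * ‖∇ f x‖ ^ 2 := by
  simp only [norm_gradient_sq, dirDeriv_exp_neg hf, mul_pow, neg_sq, ← Finset.mul_sum]

/-- The initial data `exp (-u₀)` of the linear wave `exp (-u)`. -/
noncomputable def linearData (u₀ : E3 → ℝ) (x : E3) : ℝ := Real.exp (-u₀ x)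

/-- The initial velocity of the linear wave `exp (-u)`. -/
noncomputable def linearVelocity (u₀ u₁ : E3 → ℝ) (x : E3) : ℝ := -Real.exp (-u₀ x) * u₁ x

variable {u₀ u₁ : E3 → ℝ}

theorem contDiff_linearData (h₀ : ContDiff ℝ ∞ u₀) : ContDiff ℝ ∞ (linearData u₀) := h₀.neg.exp

theorem contDiff_linearVelocity (h₀ : ContDiff ℝ ∞ u₀) (h₁ : ContDiff ℝ ∞ u₁) :
    ContDiff ℝ ∞ (linearVelocity u₀ u₁) := h₀.neg.exp.neg.mul h₁

theorem isRadial_linearData (hr₀ : IsRadial u₀) : IsRadial (linearData u₀) := fun x y h => by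
  rw [linearData, linearData, hr₀ x y h]

theorem isRadial_linearVelocity (hr₀ : IsRadial u₀) (hr₁ : IsRadial u₁) :
    IsRadial (linearVelocity u₀ u₁) := fun x y h => by
  rw [linearVelocity, linearVelocity, hr₀ x y h, hr₁ x y h]

theorem energyNorm_linearData_le (h₀ : Differentiable ℝ u₀) (hb : BddBelow (range u₀)) :
    energyNorm (linearData u₀) (linearVelocity u₀ u₁) ≤
      ENNReal.ofReal (Real.exp (-⨅ x, u₀ x)) * energyNorm u₀ u₁ := by
  refine energyNorm_le_mul (Real.exp_nonneg _) fun x => ?_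
  calc linearVelocity u₀ u₁ x ^ 2 + ‖∇ (linearData u₀) x‖ ^ 2
      = Real.exp (-u₀ x) ^ 2 * (u₁ x ^ 2 + ‖∇ u₀ x‖ ^ 2) := by
        unfold linearData linearVelocity
        rw [norm_gradient_exp_neg_sq h₀]
        ring
    _ ≤ Real.exp (-⨅ x, u₀ x) ^ 2 * (u₁ x ^ 2 + ‖∇ u₀ x‖ ^ 2) := by
        gcongr; exact ciInf_le hb x

theorem lintegral_linearData_sub_one_pow_six_lt_top (hb : BddBelow (range u₀))
    (h6 : MemLp u₀ 6 volume) : ∫⁻ x, ‖linearData u₀ x - 1‖ₑ ^ 6 < ⊤ := by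
  have hmeas : AEStronglyMeasurable (fun x => linearData u₀ x - 1) volume :=
    (Real.continuous_exp.comp_aestronglyMeasurable h6.1.neg).sub aestronglyMeasurable_const
  refine (memLp_six_iff hmeas).1 (h6.of_le_mul (c := max 1 (Real.exp (-⨅ x, u₀ x))) hmeas
    (ae_of_all _ fun x => ?_))
  refine (abs_exp_sub_one_le (-u₀ x)).trans ?_
  rw [abs_neg, Real.norm_eq_abs]
  gcongr
  exact ciInf_le hb x

/-- The wave profile of the linear wave `exp (-u)`, where `u` has data `u₀, u₁`. -/
noncomputable def nullFormProfile (u₀ u₁ : E3 → ℝ) : ℝ → ℝ :=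
  waveProfile (linearData u₀) (linearVelocity u₀ u₁)

theorem contDiff_nullFormProfile (h₀ : ContDiff ℝ ∞ u₀) (h₁ : ContDiff ℝ ∞ u₁) :
    ContDiff ℝ ∞ (nullFormProfile u₀ u₁) :=
  contDiff_waveProfile (contDiff_linearData h₀) (contDiff_linearVelocity h₀ h₁)

theorem nullFormProfile_eq (h₀ : ContDiff ℝ ∞ u₀) (s : ℝ) :
    nullFormProfile u₀ u₁ s =
      Real.exp (-profile u₀ s) * (1 - (s * deriv (profile u₀) s + s * profile u₁ s)) := by
  have hderiv : HasDerivAt (profile (linearData u₀))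
      (Real.exp (-profile u₀ s) * -deriv (profile u₀) s) s :=
    ((contDiff_profile h₀).differentiable (by simp) s).hasDerivAt.fun_neg.exp
  rw [nullFormProfile, waveProfile, hderiv.deriv]
  simp only [profile, linearData, linearVelocity]
  ring

theorem mul_deriv_eq_abs_mul_deriv_abs {p : ℝ → ℝ} (hp : Function.Even p) (s : ℝ) :
    s * deriv p s = |s| * deriv p |s| := by
  rcases abs_cases s with ⟨hs, -⟩ | ⟨hs, -⟩
  · rw [hs]
  · rw [hs, odd_deriv_of_even hp, neg_mul_neg]

theorem mul_deriv_profile_add_le {ε : ℝ} (h₀ : ContDiff ℝ ∞ u₀) (h₁ : Continuous u₁)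
    (hr₀ : IsRadial u₀) (hr₁ : IsRadial u₁)
    (hcond : ∀ x : E3, x ≠ 0 → radialDeriv u₀ x + |u₁ x| ≤ (1 - ε) / ‖x‖) (s : ℝ) :
    s * deriv (profile u₀) s + s * profile u₁ s ≤ 1 - ε := by
  have hc₀ := (contDiff_deriv_of_infty (contDiff_profile h₀)).continuous
  have hc₁ : Continuous (profile u₁) := h₁.comp (by fun_prop)
  refine closure_minimal (s := {0}ᶜ) (t := {s | _ ≤ 1 - ε}) (fun s hs => ?_)
    (isClosed_le ((continuous_id.mul hc₀).add (continuous_id.mul hc₁)) continuous_const)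
    (dense_compl_singleton (0 : ℝ) s)
  have hs : 0 < |s| := abs_pos.2 hs
  obtain ⟨x, hx⟩ : ∃ x : E3, ‖x‖ = |s| := exists_norm_eq E3 hs.le
  have hx0 : x ≠ 0 := norm_pos_iff.1 (hs.trans_eq hx.symm)
  calc s * deriv (profile u₀) s + s * profile u₁ s
      = ‖x‖ * radialDeriv u₀ x + s * u₁ x := by
        rw [mul_deriv_eq_abs_mul_deriv_abs hr₀.even_profile, ← hx,
          hr₀.deriv_profile_norm (h₀.differentiable (by simp)) hx0, hr₁.profile_eq hx.symm]
    _ ≤ ‖x‖ * radialDeriv u₀ x + ‖x‖ * |u₁ x| := by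
        rw [hx, ← abs_mul]; gcongr; exact le_abs_self _
    _ = (radialDeriv u₀ x + |u₁ x|) * ‖x‖ := by ring
    _ ≤ 1 - ε := (le_div_iff₀ (norm_pos_iff.2 hx0)).1 (hcond x hx0)

theorem le_nullFormProfile {ε : ℝ} (h₀ : ContDiff ℝ ∞ u₀) (h₁ : Continuous u₁)
    (hr₀ : IsRadial u₀) (hr₁ : IsRadial u₁) (hb : BddAbove (range u₀)) (hε : 0 ≤ ε)
    (hcond : ∀ x : E3, x ≠ 0 → radialDeriv u₀ x + |u₁ x| ≤ (1 - ε) / ‖x‖) (s : ℝ) :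
    Real.exp (-⨆ x, u₀ x) * ε ≤ nullFormProfile u₀ u₁ s := by
  have hbound := mul_deriv_profile_add_le h₀ h₁ hr₀ hr₁ hcond s
  rw [nullFormProfile_eq h₀]
  gcongr
  · exact le_ciSup hb _
  · linarith

theorem lintegral_nullFormProfile_sub_one_sq_le (h₀ : ContDiff ℝ ∞ u₀) (h₁ : ContDiff ℝ ∞ u₁)
    (hr₀ : IsRadial u₀) (hr₁ : IsRadial u₁) (hb : BddBelow (range u₀)) (h6 : MemLp u₀ 6 volume) :
    ∫⁻ s, ‖nullFormProfile u₀ u₁ s - 1‖ₑ ^ 2 ≤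
      4 * (ENNReal.ofReal (Real.exp (-⨅ x, u₀ x)) * energyNorm u₀ u₁) ^ 2 := by
  refine (lintegral_waveProfile_sub_one_sq_le (contDiff_linearData h₀)
    (contDiff_linearVelocity h₀ h₁).continuous (isRadial_linearData hr₀)
    (isRadial_linearVelocity hr₀ hr₁)
    (lintegral_linearData_sub_one_pow_six_lt_top hb h6)).trans ?_
  rw [← energyNorm_sq_eq_lintegral]
  gcongr
  exact energyNorm_linearData_le (h₀.differentiable (by simp)) hb

end LinearizedData

section Solution

/-- The linear wave `exp (-u)`, where `u` has data `u₀, u₁`: the average of its profile over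
`[t - |x|, t + |x|]`. -/
noncomputable def linearizedWave (u₀ u₁ : E3 → ℝ) (p : ℝ × E3) : ℝ :=
  2⁻¹ * radialMean 0 (nullFormProfile u₀ u₁) p

variable {u₀ u₁ : E3 → ℝ} {u : ℝ → E3 → ℝ}

theorem isLinearWave_linearizedWave (h₀ : ContDiff ℝ ∞ u₀) (h₁ : ContDiff ℝ ∞ u₁) :
    IsLinearWave (linearizedWave u₀ u₁) :=
  (isLinearWave_radialMean (k := 0) finrank_euclideanSpace_fin
    (contDiff_nullFormProfile h₀ h₁)).const_mul 2⁻¹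

theorem linearizedWave_zero (h₀ : ContDiff ℝ ∞ u₀) (h₁ : ContDiff ℝ ∞ u₁) (hr₀ : IsRadial u₀)
    (hr₁ : IsRadial u₁) (x : E3) : linearizedWave u₀ u₁ (0, x) = linearData u₀ x :=
  half_radialMean_waveProfile (contDiff_linearData h₀) (contDiff_linearVelocity h₀ h₁)
    (isRadial_linearData hr₀) (isRadial_linearVelocity hr₀ hr₁) x

theorem dirDeriv_timeDir_linearizedWave_zero (h₀ : ContDiff ℝ ∞ u₀) (h₁ : ContDiff ℝ ∞ u₁)
    (hr₀ : IsRadial u₀) (hr₁ : IsRadial u₁) (x : E3) :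
    dirDeriv timeDir (linearizedWave u₀ u₁) (0, x) = linearVelocity u₀ u₁ x := by
  have hh := contDiff_nullFormProfile h₀ h₁
  unfold linearizedWave
  rw [dirDeriv_const_mul ((contDiff_radialMean 0 hh).differentiable (by simp) _),
    dirDeriv_timeDir_radialMean 0 (hh.of_le (WithTop.coe_le_coe.2 le_top))]
  exact half_radialMean_deriv_waveProfile (contDiff_linearData h₀) (contDiff_linearVelocity h₀ h₁)
    (isRadial_linearData hr₀) (isRadial_linearVelocity hr₀ hr₁) x

theorem le_linearizedWave {ε : ℝ} (h₀ : ContDiff ℝ ∞ u₀) (h₁ : ContDiff ℝ ∞ u₁)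
    (hr₀ : IsRadial u₀) (hr₁ : IsRadial u₁) (hb : BddAbove (range u₀)) (hε : 0 ≤ ε)
    (hcond : ∀ x : E3, x ≠ 0 → radialDeriv u₀ x + |u₁ x| ≤ (1 - ε) / ‖x‖) (p : ℝ × E3) :
    Real.exp (-⨆ x, u₀ x) * ε ≤ linearizedWave u₀ u₁ p :=
  le_half_weightedMean_zero (contDiff_nullFormProfile h₀ h₁).continuous
    (le_nullFormProfile h₀ h₁.continuous hr₀ hr₁ hb hε hcond) _

theorem isNullFormSolution_neg_log_linearizedWave (h₀ : ContDiff ℝ ∞ u₀) (h₁ : ContDiff ℝ ∞ u₁)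
    (hr₀ : IsRadial u₀) (hr₁ : IsRadial u₁) (hpos : ∀ p, 0 < linearizedWave u₀ u₁ p) :
    IsNullFormSolution (fun t x => -Real.log (linearizedWave u₀ u₁ (t, x))) u₀ u₁ := by
  have hW := isLinearWave_linearizedWave h₀ h₁
  convert (hW.neg_log hpos).isNullFormSolution with x x
  · rw [linearizedWave_zero h₀ h₁ hr₀ hr₁, linearData, Real.log_exp, neg_neg]
  · rw [dirDeriv_neg_log (hW.smooth.differentiable (by simp) _) (hpos _).ne',
      dirDeriv_timeDir_linearizedWave_zero h₀ h₁ hr₀ hr₁, linearizedWave_zero h₀ h₁ hr₀ hr₁,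
      linearVelocity, linearData]
    field_simp

namespace IsNullFormSolution

theorem exp_neg_eq (hu : IsNullFormSolution u u₀ u₁) (h₀ : ContDiff ℝ ∞ u₀)
    (h₁ : ContDiff ℝ ∞ u₁) (hr₀ : IsRadial u₀) (hr₁ : IsRadial u₁) (t : ℝ) (x : E3) :
    Real.exp (-u t x) = linearizedWave u₀ u₁ (t, x) := by
  refine congrFun (hu.isNullFormWave.exp_neg.ext_of_initial (isLinearWave_linearizedWave h₀ h₁)
    (fun x => ?_) fun x => ?_) (t, x)
  · rw [linearizedWave_zero h₀ h₁ hr₀ hr₁, hu.init, linearData]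
  · rw [dirDeriv_timeDir_linearizedWave_zero h₀ h₁ hr₀ hr₁,
      dirDeriv_exp_neg (hu.smooth.differentiable (by simp)), hu.dirDeriv_timeDir_zero, hu.init,
      linearVelocity]

theorem exp_le {ε : ℝ} (hu : IsNullFormSolution u u₀ u₁) (h₀ : ContDiff ℝ ∞ u₀)
    (h₁ : ContDiff ℝ ∞ u₁) (hr₀ : IsRadial u₀) (hr₁ : IsRadial u₁) (hb : BddAbove (range u₀))
    (hε : 0 < ε) (hcond : ∀ x : E3, x ≠ 0 → radialDeriv u₀ x + |u₁ x| ≤ (1 - ε) / ‖x‖)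
    (t : ℝ) (x : E3) : Real.exp (u t x) ≤ Real.exp (⨆ x, u₀ x) * ε⁻¹ := by
  have hle := le_linearizedWave h₀ h₁ hr₀ hr₁ hb hε.le hcond (t, x)
  rw [← hu.exp_neg_eq h₀ h₁ hr₀ hr₁, Real.exp_neg, Real.exp_neg, inv_mul_eq_div] at hle
  have hinv := inv_anti₀ (by positivity) hle
  rwa [inv_inv, inv_div, div_eq_mul_inv] at hinv

theorem contDiff_slice (hu : IsNullFormSolution u u₀ u₁) (t : ℝ) : ContDiff ℝ ∞ (u t) :=
  hu.smooth.comp (contDiff_const.prodMk contDiff_id)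

theorem continuous_timeDeriv (hu : IsNullFormSolution u u₀ u₁) (t : ℝ) :
    Continuous (timeDeriv u t) := by
  rw [timeDeriv_eq_dirDeriv (hu.smooth.differentiable (by simp))]
  exact (contDiff_dirDeriv hu.smooth timeDir).continuous.comp (by fun_prop)

end IsNullFormSolution

end Solution

section Estimates

variable {u₀ u₁ : E3 → ℝ} {u : ℝ → E3 → ℝ} {M : ℝ}

theorem normL2Linfty_le_mul {w : ℝ → E3 → ℝ} {c : ℝ} (h : ∀ t x, ‖u t x‖ ≤ c * ‖w t x‖) :
    normL2Linfty u ≤ ENNReal.ofReal c * normL2Linfty w := by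
  refine rpow_half_le_iff.2 ?_
  calc ∫⁻ t, eLpNorm (u t) ⊤ volume ^ 2
      ≤ ∫⁻ t, ENNReal.ofReal c ^ 2 * eLpNorm (w t) ⊤ volume ^ 2 := by
        refine lintegral_mono fun t => ?_
        rw [← mul_pow]
        gcongr
        exact eLpNorm_le_mul_eLpNorm_of_ae_le_mul (ae_of_all _ (h t)) ⊤
    _ = (ENNReal.ofReal c * normL2Linfty w) ^ 2 := by
        rw [lintegral_const_mul' _ _ (by finiteness), mul_pow, normL2Linfty, one_div,
          ← ENNReal.rpow_two (_ ^ _), ENNReal.rpow_inv_rpow two_ne_zero]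

theorem eLpNorm_half_radialMean_zero_le_maximalFunction (g : ℝ → ℝ) (t : ℝ) :
    eLpNorm (fun x : E3 => 2⁻¹ * radialMean 0 g (t, x)) ⊤ volume ≤
      maximalFunction volume (fun s => ‖g s‖ₑ) t := by
  rw [eLpNorm_exponent_top]
  refine essSup_le_of_ae_le _ ?_
  filter_upwards [compl_mem_ae_iff.2 (measure_singleton (0 : E3))] with x hx
  exact enorm_half_weightedMean_zero_le_maximalFunction g
    (Metric.mem_ball_self (norm_pos_iff.2 hx))

theorem normL2Linfty_half_radialMean_zero_le {g : ℝ → ℝ} (hg : Measurable g) :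
    normL2Linfty (fun t x => 2⁻¹ * radialMean 0 g (t, x)) ≤
      (40 * ∫⁻ s, ‖g s‖ₑ ^ 2) ^ (1 / 2 : ℝ) := by
  refine ENNReal.rpow_le_rpow ?_ (by norm_num)
  refine le_trans (lintegral_mono fun t => ?_) (lintegral_maximalFunction_sq_le hg.enorm)
  gcongr
  exact eLpNorm_half_radialMean_zero_le_maximalFunction g t

namespace IsNullFormSolution

theorem energyNorm_le (hu : IsNullFormSolution u u₀ u₁) (hb : BddBelow (range u₀))
    (hM : ∀ t x, Real.exp (u t x) ≤ M) (t : ℝ) :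
    energyNorm (u t) (timeDeriv u t) ≤
      ENNReal.ofReal M * (ENNReal.ofReal (Real.exp (-⨅ x, u₀ x)) * energyNorm u₀ u₁) := by
  have hd : Differentiable ℝ fun p : ℝ × E3 => u p.1 p.2 := hu.smooth.differentiable (by simp)
  have hW := hu.isNullFormWave.exp_neg
  have hWd := hW.smooth.differentiable (by simp)
  calc energyNorm (u t) (timeDeriv u t)
      ≤ ENNReal.ofReal M * energyNorm (fun x => Real.exp (-u t x))
          (timeDeriv (fun t x => Real.exp (-u t x)) t) := by
        refine energyNorm_le_mul ((Real.exp_nonneg _).trans (hM 0 0)) fun x => ?_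
        rw [← energyDensity_eq_timeDeriv_gradient hd, ← energyDensity_eq_timeDeriv_gradient hWd,
          energyDensity_exp_neg hd, ← mul_assoc, ← mul_pow]
        refine le_mul_of_one_le_left (energyDensity_nonneg _ _) (one_le_pow₀ ?_)
        rw [Real.exp_neg, ← div_eq_mul_inv, one_le_div (Real.exp_pos _)]
        exact hM t x
    _ ≤ ENNReal.ofReal M * energyNorm (fun x => Real.exp (-u 0 x))
          (timeDeriv (fun t x => Real.exp (-u t x)) 0) := by
        gcongr; exact hW.energyNorm_slice_le t
    _ = ENNReal.ofReal M * energyNorm (linearData u₀) (linearVelocity u₀ u₁) := by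
        congr 2 with x
        · rw [hu.init, linearData]
        · simp only [timeDeriv_eq_dirDeriv hWd]
          rw [dirDeriv_exp_neg hd, hu.dirDeriv_timeDir_zero, hu.init, linearVelocity]
    _ ≤ ENNReal.ofReal M *
          (ENNReal.ofReal (Real.exp (-⨅ x, u₀ x)) * energyNorm u₀ u₁) := by
        gcongr
        refine energyNorm_linearData_le ?_ hb
        exact funext hu.init ▸ (hu.contDiff_slice 0).differentiable (by simp)

theorem norm_le (hu : IsNullFormSolution u u₀ u₁) (h₀ : ContDiff ℝ ∞ u₀) (h₁ : ContDiff ℝ ∞ u₁)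
    (hr₀ : IsRadial u₀) (hr₁ : IsRadial u₁) (hM : ∀ t x, Real.exp (u t x) ≤ M) (t : ℝ) (x : E3) :
    ‖u t x‖ ≤
      max 1 M * ‖2⁻¹ * radialMean 0 (fun s => nullFormProfile u₀ u₁ s - 1) (t, x)‖ := by
  have hmean : Real.exp (-u t x) - 1 =
      2⁻¹ * radialMean 0 (fun s => nullFormProfile u₀ u₁ s - 1) (t, x) := by
    rw [hu.exp_neg_eq h₀ h₁ hr₀ hr₁]
    exact half_weightedMean_zero_sub_one (contDiff_nullFormProfile h₀ h₁).continuous _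
  have hle := abs_le_mul_abs_exp_sub_one (-u t x)
  rw [abs_neg, neg_neg] at hle
  rw [← hmean, Real.norm_eq_abs, Real.norm_eq_abs]
  exact hle.trans (by gcongr; exact hM t x)

theorem memLp_six (hu : IsNullFormSolution u u₀ u₁) (h₀ : ContDiff ℝ ∞ u₀) (h₁ : ContDiff ℝ ∞ u₁)
    (hr₀ : IsRadial u₀) (hr₁ : IsRadial u₁) (hM : ∀ t x, Real.exp (u t x) ≤ M)
    (hL2 : ∫⁻ s, ‖nullFormProfile u₀ u₁ s - 1‖ₑ ^ 2 < ⊤) (t : ℝ) : MemLp (u t) 6 volume := by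
  have hh : ContDiff ℝ ∞ fun s => nullFormProfile u₀ u₁ s - 1 :=
    (contDiff_nullFormProfile h₀ h₁).sub contDiff_const
  have hmean : Continuous fun x : E3 =>
      2⁻¹ * radialMean 0 (fun s => nullFormProfile u₀ u₁ s - 1) (t, x) :=
    continuous_const.mul ((contDiff_radialMean 0 hh).continuous.comp (by fun_prop))
  exact ((memLp_six_iff hmean.aestronglyMeasurable).2
    (lintegral_enorm_half_radialMean_zero_pow_six_lt_top hh.continuous hL2 t)).of_le_mul
    (hu.contDiff_slice t).continuous.aestronglyMeasurable
    (ae_of_all _ (hu.norm_le h₀ h₁ hr₀ hr₁ hM t))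

theorem normL2Linfty_le (hu : IsNullFormSolution u u₀ u₁) (h₀ : ContDiff ℝ ∞ u₀)
    (h₁ : ContDiff ℝ ∞ u₁) (hr₀ : IsRadial u₀) (hr₁ : IsRadial u₁) (hb : BddBelow (range u₀))
    (h6 : MemLp u₀ 6 volume) (hM : ∀ t x, Real.exp (u t x) ≤ M) :
    normL2Linfty u ≤ ENNReal.ofReal (13 * max 1 M * Real.exp (-⨅ x, u₀ x)) * energyNorm u₀ u₁ := by
  let N : ℝ≥0∞ := ENNReal.ofReal (Real.exp (-⨅ x, u₀ x)) * energyNorm u₀ u₁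
  calc normL2Linfty u
      ≤ ENNReal.ofReal (max 1 M) * (40 * ∫⁻ s, ‖nullFormProfile u₀ u₁ s - 1‖ₑ ^ 2) ^ (1 / 2 : ℝ) :=
        (normL2Linfty_le_mul (hu.norm_le h₀ h₁ hr₀ hr₁ hM)).trans (by
          gcongr
          exact normL2Linfty_half_radialMean_zero_le
            ((contDiff_nullFormProfile h₀ h₁).continuous.measurable.sub_const 1))
    _ ≤ ENNReal.ofReal (max 1 M) * (13 * N) := by
        gcongr
        refine rpow_half_le_iff.2 ?_
        calc 40 * ∫⁻ s, ‖nullFormProfile u₀ u₁ s - 1‖ₑ ^ 2 ≤ 40 * (4 * N ^ 2) := by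
              gcongr
              exact lintegral_nullFormProfile_sub_one_sq_le h₀ h₁ hr₀ hr₁ hb h6
          _ = 160 * N ^ 2 := by rw [← mul_assoc]; norm_num
          _ ≤ 169 * N ^ 2 := by gcongr; norm_num
          _ = (13 * N) ^ 2 := by rw [mul_pow 13 N]; norm_num
    _ = ENNReal.ofReal (13 * max 1 M * Real.exp (-⨅ x, u₀ x)) * energyNorm u₀ u₁ := by
        rw [ENNReal.ofReal_mul (by positivity), ENNReal.ofReal_mul (by norm_num),
          ENNReal.ofReal_ofNat]
        ring

end IsNullFormSolution

end Estimates

theorem mainTheorem9 :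
    ∃ C : ℝ, 0 < C ∧
      ∀ (u₀ u₁ : E3 → ℝ) (ε : ℝ),
        ContDiff ℝ ∞ u₀ → ContDiff ℝ ∞ u₁ → IsRadial u₀ → IsRadial u₁ →
        MemLp u₀ ⊤ volume → MemHDot u₀ → MemLp u₁ 2 volume →
        0 < ε →
        (∀ x : E3, x ≠ 0 → radialDeriv u₀ x + |u₁ x| ≤ (1 - ε) / ‖x‖) →
        (∃ u : ℝ → E3 → ℝ, IsNullFormSolution u u₀ u₁) ∧
        ∀ u : ℝ → E3 → ℝ, IsNullFormSolution u u₀ u₁ →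
          ((∀ t : ℝ, MemHDot (u t)) ∧ (⨆ t : ℝ, hDotNorm (u t)) < ⊤) ∧
          normL2Linfty u < ⊤ ∧
          ((∀ t : ℝ, MemLp (timeDeriv u t) 2 volume) ∧
            (⨆ t : ℝ, eLpNorm (timeDeriv u t) 2 volume) < ⊤) ∧
          (⨆ t : ℝ, energyNorm (u t) (timeDeriv u t)) ≤
            ENNReal.ofReal (Real.exp ((⨆ x, u₀ x) - (⨅ x, u₀ x)) * ε⁻¹) *
              energyNorm u₀ u₁ ∧
          normL2Linfty u ≤
            ENNReal.ofReal
              (C * max 1 (Real.exp (⨆ x, u₀ x) * ε⁻¹) * Real.exp (-(⨅ x, u₀ x))) *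
                energyNorm u₀ u₁ := by
  refine ⟨13, by norm_num, fun u₀ u₁ ε h₀ h₁ hr₀ hr₁ htop hdot hL2 hε hcond => ?_⟩
  have hbdd := isBounded_range_of_memLp_top h₀.continuous htop
  have hpos : ∀ p, 0 < linearizedWave u₀ u₁ p := fun p => lt_of_lt_of_le (by positivity)
    (le_linearizedWave h₀ h₁ hr₀ hr₁ hbdd.bddAbove hε.le hcond p)
  refine ⟨⟨_, isNullFormSolution_neg_log_linearizedWave h₀ h₁ hr₀ hr₁ hpos⟩, fun u hu => ?_⟩
  have hN : energyNorm u₀ u₁ < ⊤ := energyNorm_lt_top hdot hL2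
  have hM := hu.exp_le h₀ h₁ hr₀ hr₁ hbdd.bddAbove hε hcond
  have henergy : ∀ t, energyNorm (u t) (timeDeriv u t) ≤
      ENNReal.ofReal (Real.exp ((⨆ x, u₀ x) - ⨅ x, u₀ x) * ε⁻¹) * energyNorm u₀ u₁ := fun t => by
    refine (hu.energyNorm_le hbdd.bddBelow hM t).trans_eq ?_
    rw [← mul_assoc, ← ENNReal.ofReal_mul (by positivity), mul_right_comm, ← Real.exp_add,
      sub_eq_add_neg]
  have hstrichartz := hu.normL2Linfty_le h₀ h₁ hr₀ hr₁ hbdd.bddBelow hdot.1 hM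
  have hgrad := fun t => (hDotNorm_le_energyNorm (u t) (timeDeriv u t)).trans (henergy t)
  have hvel := fun t => (eLpNorm_le_energyNorm (u t) (timeDeriv u t)).trans (henergy t)
  have hprofile := (lintegral_nullFormProfile_sub_one_sq_le h₀ h₁ hr₀ hr₁ hbdd.bddBelow
    hdot.1).trans_lt (by finiteness)
  have hL6 := hu.memLp_six h₀ h₁ hr₀ hr₁ hM hprofile
  exact ⟨⟨fun t => ⟨hL6 t, (measurable_gradient (u t)).aestronglyMeasurable,
      (hgrad t).trans_lt (by finiteness)⟩, (iSup_le hgrad).trans_lt (by finiteness)⟩,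
    hstrichartz.trans_lt (by finiteness),
    ⟨fun t => ⟨(hu.continuous_timeDeriv t).aestronglyMeasurable,
      (hvel t).trans_lt (by finiteness)⟩, (iSup_le hvel).trans_lt (by finiteness)⟩,
    iSup_le henergy, hstrichartz⟩
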